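/- Let $N\ge 128$, $r\ge 0$, and let $f:[-1,1]\to\mathbb C$ be a spline of degree $r$ with knots $-1<x_1<\dots<x_M<1$; that is, $f$ is $(r-1)$ times continuously differentiable (no condition if $r=0$) and agrees with a complex polynomial of degree at most $r$ on each of $[-1,x_1),[x_1,x_2),\dots,[x_M,1]$. Assume that the knots lie in $\left[\cos(-\pi+\tfrac{2\pi}{N}),\cos(-\tfrac{2\pi}{N})\right]$ and that $|\arccos x_i-\arccos x_k|\ge \tfrac{4\pi}{N}$ for $i\ne k$ (the separation condition). Let $V_N$ be the space of complex algebraic polynomials of degree at most $N$, let $q\in V_N$ be the projection of $f$ onto $V_N$ (so $\int_{-1}^1 fP=\int_{-1}^1 qP$ for all $P\in V_N$), and let $a_j=f^{(j)}(-1)$, $b_j=f^{(j)}(1)$ be the (one-sided) boundary derivatives. Then $f$ is uniquely recovered through total variation (TV) minimization: 1. Among all complex Borel measures $g$ on $[-1,1]$ that satisfy, for all $P\in V_N$, $$\int_{[-1,1]}P\,dg=\sum_{i=0}^{r}(-1)^i\left(b_{r-i}P^{(i)}(1)-a_{r-i}P^{(i)}(-1)\right)+(-1)^{r+1}\int_{-1}^1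 q\,P^{(r+1)}\,dx ,$$ there is a unique one of minimal TV norm. It is the Dirac train $g=\sum_{m=1}^M c_m\delta_{x_m}$ ($c_m\in\mathbb C$) which is the distributional derivative $f^{(r+1)}$ of $f$, and for all $t\in[-1,1]$ $$f(t)=\sum_{j=0}^{r}\frac{a_j}{j!}(t+1)^j+\int_{[-1,t]}\frac{(t-s)^r}{r!}\,dg(s).$$ 2. Moreover, among all splines of degree $r$ on $[-1,1]$, with any finite number of knots, that satisfy the separation condition, $f$ is the only one that has projection $q$ onto $V_N$ and has the boundary values $a_j,b_j$ for $0\le j<r$. -/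

import Mathlib

open MeasureTheory Polynomial
open scoped ContDiff Nat

noncomputable section

namespace SplineRecovery

/-- The interval `[-1, 1]`. -/
abbrev I : Set ℝ := Set.Icc (-1 : ℝ) 1

/-- The Chebyshev-type separation condition: `X` lies in
`[cos (-π + 2π/N), cos (-2π/N)]`, and distinct points of `X` are at distance at least `4π/N`
for the metric `ρ (s, t) = |arccos s - arccos t|`. -/
def MinSeparated (N : ℕ) (X : Set ℝ) : Prop :=
  X ⊆ Set.Icc (Real.cos (-Real.pi + 2 * Real.pi / N)) (Real.cos (-(2 * Real.pi / N))) ∧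
    X.Pairwise fun s t => 4 * Real.pi / N ≤ |Real.arccos s - Real.arccos t|

/-- `f` restricted to `[-1, 1]` is a (complex) spline of degree `r` over the knot sequence
`-1 < x 0 < ... < x (M - 1) < 1`: it is `r - 1` times continuously differentiable on `[-1, 1]`
(no condition if `r = 0`) and agrees with a polynomial `p m` of degree at most `r` on the `m`-th
piece. The pieces are `[-1, x 0)`, `[x 0, x 1)`, ..., `[x (M - 1), 1]`: the `m`-th one consists of
the `t ∈ [-1, 1]` such that the knots that are `≤ t` are exactly the first `m` knots. -/
structure IsSpline (r : ℕ) {M : ℕ} (x : Fin M → I) (f : ℝ → ℂ) : Prop where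
  strictMono_knots : StrictMono x
  knots_mem : ∀ i, (x i : ℝ) ∈ Set.Ioo (-1 : ℝ) 1
  contDiffOn : ∀ k : ℕ, k < r → ContDiffOn ℝ k f I
  exists_pieces : ∃ p : Fin (M + 1) → ℂ[X], (∀ m, (p m).natDegree ≤ r) ∧
    ∀ m : Fin (M + 1), ∀ t ∈ I, (∀ i : Fin M, (x i : ℝ) ≤ t ↔ i.castSucc < m) →
      f t = (p m).eval (t : ℂ)

/-- `q` is the projection of `f` onto the space `V_N` of polynomials of degree at most `N`:
`q ∈ V_N` and `⟨f, P⟩ = ⟨q, P⟩` for all `P ∈ V_N`. (As `V_N` is stable under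
conjugation of the coefficients, this is the orthogonal projection in `L²(-1, 1)`.) -/
def IsProjection (N : ℕ) (f : ℝ → ℂ) (q : ℂ[X]) : Prop :=
  q.natDegree ≤ N ∧ ∀ P : ℂ[X], P.natDegree ≤ N →
    ∫ t in (-1 : ℝ)..1, f t * P.eval (t : ℂ) = ∫ t in (-1 : ℝ)..1, q.eval (t : ℂ) * P.eval (t : ℂ)

/-- `f^{(j)}(s)`, the derivative being taken within `[-1, 1]` (hence one-sided at `s = ±1`). -/
def bdryDeriv (f : ℝ → ℂ) (s : ℝ) (j : ℕ) : ℂ := iteratedDerivWithin j f I s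

/-- The pairing `⟨h, g⟩ = ∫ h dg` of a function with a complex Borel measure on `[-1, 1]`. -/
def pairing (h : ℝ → ℂ) (g : ComplexMeasure I) : ℂ :=
  g.integral (fun s : I => h s) (ContinuousLinearMap.mul ℝ ℂ)

/-- The total variation norm of a complex Borel measure on `[-1, 1]`. -/
def tvNorm (g : ComplexMeasure I) : ENNReal := g.variation Set.univ

/-- `g` is the distributional derivative of order `n` of `f` on `(-1, 1)`. -/
def IsDistribDeriv (n : ℕ) (f : ℝ → ℂ) (g : ComplexMeasure I) : Prop :=
  ∀ u : ℝ → ℂ, ContDiff ℝ ∞ u → HasCompactSupport u → tsupport u ⊆ Set.Ioo (-1) 1 →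
    ∫ t in (-1 : ℝ)..1, f t * iteratedDeriv n u t = (-1) ^ n * pairing u g

/-- The inner product `⟨f^{(r+1)}, P⟩` as computed by `r + 1` integrations by parts from the
projection `q` of `f` and the boundary values `a j = f^{(j)}(-1)`, `b j = f^{(j)}(1)`, `j ≤ r`. -/
def momentFromData (r : ℕ) (q : ℂ[X]) (a b : ℕ → ℂ) (P : ℂ[X]) : ℂ :=
  ∑ i ∈ Finset.range (r + 1), (-1) ^ i *
      (b (r - i) * (derivative^[i] P).eval 1 - a (r - i) * (derivative^[i] P).eval (-1)) +
    (-1) ^ (r + 1) *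
      ∫ t in (-1 : ℝ)..1, q.eval (t : ℂ) * (derivative^[r + 1] P).eval (t : ℂ)

/-- The complex measures `g` on `[-1, 1]` whose inner products with all polynomials of degree at
most `N` are the ones computed from the data. -/
def feasible (N r : ℕ) (q : ℂ[X]) (a b : ℕ → ℂ) : Set (ComplexMeasure I) :=
  {g | ∀ P : ℂ[X], P.natDegree ≤ N →
    pairing (fun s => P.eval (s : ℂ)) g = momentFromData r q a b P}

/-- `g` is the unique solution of `min ‖h‖_TV` subject to `h ∈ C`. -/
def IsUniqueTVMinimizer (C : Set (ComplexMeasure I)) (g : ComplexMeasure I) : Prop :=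
  g ∈ C ∧ ∀ h ∈ C, h ≠ g → tvNorm g < tvNorm h

/-- The `(r + 1)`-fold antiderivative of `g` with boundary values `a j`, `j ≤ r`, at `-1`:
`∑_{j ≤ r} a_j (t + 1)^j / j! + ∫_{[-1, t]} (t - s)^r / r! dg(s)`. -/
def integrateBack (r : ℕ) (a : ℕ → ℂ) (g : ComplexMeasure I) (t : ℝ) : ℂ :=
  ∑ j ∈ Finset.range (r + 1), a j * (t + 1) ^ j / j ! +
    pairing (fun s => if s ≤ t then ((t : ℂ) - s) ^ r / r ! else 0) g

end SplineRecovery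

end

open SplineRecovery

/-!
The Dirac train `∑ c_m δ_{x_m}` of the jumps of `f^{(r)}` is feasible because `r + 1` integrations
by parts turn `∫ f P^{(r+1)} = ∫ q P^{(r+1)}` into its moments
(`IsTruncatedPowerSum.momentFromData_eq`). The same integration by parts against test functions
shows that it is the distributional derivative, and Taylor's formula recovers `f` from it.

It is the unique minimizer of the TV norm because of a dual certificate
(`exists_dualCertificate`): for every choice of unimodular values `u_m` there is a polynomial `P` of
degree at most `N` with `P (x_m) = u_m` and `|P| < 1` off the knots. With
`u_m c_m = |c_m|` any measure `h` with the same moments satisfies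
`∑ |c_m| = ∫ P dh ≤ ∫ |P| d|h| ≤ |h|`, strictly unless `h` lives on the knots; and then `h` is
determined by its moments (`tvNorm_lt_of_pairing_eq`).

The certificate is built on the circle. With `t = cos θ` each knot has the two preimages `± θ_m`,
and the separation condition makes all of these `4π/N`-separated. In the variable `x = m θ / 2`,
`m = ⌊(N + 1) / 2⌋`, the circle has length `m π` and the nodes are `π`-separated, so
that `sin x ^ 4 / (m sin (x / m)) ^ 4` and `sin x ^ 4 cos (x / m) / (m sin (x / m)) ^ 3`, which are
close to `(sin x / x) ^ 4` and `sin x ^ 4 / x ^ 3`, nearly solve the Hermite interpolation problem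
with values `u` and vanishing slopes. The system for the exact coefficients is diagonally dominant
(`exists_interpolation_coeffs`). Near a node `|P| < 1` follows from the quadratic decay of the first
kernel against the second order Taylor remainders of all other terms, elsewhere from the size of the
kernels (`norm_interpolant_lt_one_of_near`, `norm_interpolant_lt_one_of_far`). Averaging over the
preimages of `t` gives an algebraic polynomial (`IsTrigPoly.exists_polynomial`).

For the last assertion, the difference of the moments of two such splines is a combination of point
evaluations at the knots and at `± 1`, the latter with the unknown differences of the `r`-th
boundary derivatives as weights. Separation leaves at most `N + 1` points
(`card_le_of_minSeparated`), where polynomials of degree at most `N` take arbitrary values, so all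
weights vanish.
-/

noncomputable section

namespace SplineRecovery

/-! ### Kernels on the circle -/

open Real in
/-- The rescaled chord `m sin (x / m)`: the point of the unit circle at angle `2x / m` is at
distance `2 |m sin (x / m)| / m` from `1`. As `m → ∞` it becomes `x`. -/
def chord (m : ℕ) (x : ℝ) : ℝ := m * sin (x / m)

open Real in
/-- The Dirichlet kernel `sin x / (m sin (x / m))`, a polynomial in `cos (x / m)`; this gives the
right value at the zeros of the denominator. -/
def dirichlet (m : ℕ) (x : ℝ) : ℝ := (Chebyshev.U ℝ ((m : ℤ) - 1)).eval (cos (x / m)) / m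

/-- The kernel that carries the interpolated values: `(sin x / chord x) ^ 4`, the discrete analogue
of `(sin x / x) ^ 4`. -/
def valueKernel (m : ℕ) (x : ℝ) : ℝ := dirichlet m x ^ 4

open Real in
/-- The odd kernel that corrects the slopes at the nodes: `sin x ^ 4 cos (x / m) / chord x ^ 3`,
the discrete analogue of `sin x ^ 4 / x ^ 3`. -/
def slopeKernel (m : ℕ) (x : ℝ) : ℝ := dirichlet m x ^ 3 * (sin x * cos (x / m))

open Real in
/-- The derivative of `valueKernel`, away from the zeros of `chord`. -/
def valueKernelDeriv (m : ℕ) (x : ℝ) : ℝ :=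
  4 * sin x ^ 3 * cos x / chord m x ^ 4 - 4 * sin x ^ 4 * cos (x / m) / chord m x ^ 5

open Real in
/-- The derivative of `slopeKernel`, away from the zeros of `chord`. -/
def slopeKernelDeriv (m : ℕ) (x : ℝ) : ℝ :=
  4 * sin x ^ 3 * cos x * cos (x / m) / chord m x ^ 3 -
    sin x ^ 4 * (1 / (m ^ 2 * chord m x ^ 2) + 3 * cos (x / m) ^ 2 / chord m x ^ 4)

open Real in
/-- The second derivative of `valueKernel`, away from the zeros of `chord`. -/
def valueKernelDeriv₂ (m : ℕ) (x : ℝ) : ℝ :=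
  (12 * sin x ^ 2 * cos x ^ 2 - 4 * sin x ^ 4) / chord m x ^ 4 -
    32 * (sin x ^ 3 * cos x) * cos (x / m) / chord m x ^ 5 +
    sin x ^ 4 * (20 * cos (x / m) ^ 2 / chord m x ^ 6 + 4 / (m ^ 2 * chord m x ^ 4))

open Real in
/-- The second derivative of `slopeKernel`, away from the zeros of `chord`. -/
def slopeKernelDeriv₂ (m : ℕ) (x : ℝ) : ℝ :=
  (12 * sin x ^ 2 * cos x ^ 2 - 4 * sin x ^ 4) * cos (x / m) / chord m x ^ 3 -
    8 * (sin x ^ 3 * cos x) *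
      (1 / (m ^ 2 * chord m x ^ 2) + 3 * cos (x / m) ^ 2 / chord m x ^ 4) +
    sin x ^ 4 * (8 * cos (x / m) / (m ^ 2 * chord m x ^ 3) + 12 * cos (x / m) ^ 3 / chord m x ^ 5)

section Kernels

open Real

variable {m : ℕ} {x t : ℝ}

lemma dirichlet_mul_chord (hm : 0 < m) (x : ℝ) : dirichlet m x * chord m x = sin x := by
  have hm' : (m : ℝ) ≠ 0 := by positivity
  have h := Chebyshev.U_real_cos (x / m) ((m : ℤ) - 1)
  push_cast at h
  rw [sub_add_cancel, mul_div_cancel₀ _ hm'] at h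
  rw [← h, dirichlet, chord]
  field_simp

lemma dirichlet_eq_div (hm : 0 < m) (h : chord m x ≠ 0) : dirichlet m x = sin x / chord m x := by
  rw [eq_div_iff h, dirichlet_mul_chord hm]

lemma valueKernel_eq (hm : 0 < m) (h : chord m x ≠ 0) :
    valueKernel m x = sin x ^ 4 / chord m x ^ 4 := by
  rw [valueKernel, dirichlet_eq_div hm h, div_pow]

lemma slopeKernel_eq (hm : 0 < m) (h : chord m x ≠ 0) :
    slopeKernel m x = sin x ^ 4 * cos (x / m) / chord m x ^ 3 := by
  rw [slopeKernel, dirichlet_eq_div hm h, div_pow]; ring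

lemma valueKernel_zero (hm : 0 < m) : valueKernel m 0 = 1 := by
  have hm' : (m : ℝ) ≠ 0 := by positivity
  simp [valueKernel, dirichlet, hm']

lemma slopeKernel_zero : slopeKernel m 0 = 0 := by simp [slopeKernel]

lemma hasDerivAt_cos_div (m : ℕ) (x : ℝ) :
    HasDerivAt (fun x => cos (x / m)) (-sin (x / m) / m) x := by
  simpa [div_eq_mul_inv] using ((hasDerivAt_id x).div_const (m : ℝ)).cos

lemma hasDerivAt_chord (hm : 0 < m) (x : ℝ) : HasDerivAt (chord m) (cos (x / m)) x := by
  have hm' : (m : ℝ) ≠ 0 := by positivity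
  have h := (((hasDerivAt_id x).div_const (m : ℝ)).sin).const_mul (m : ℝ)
  refine h.congr_deriv ?_
  simp only [id]
  field_simp

lemma continuous_chord (hm : 0 < m) : Continuous (chord m) :=
  continuous_iff_continuousAt.2 fun x => (hasDerivAt_chord hm x).continuousAt

lemma eventually_chord_ne_zero (hm : 0 < m) (h : chord m x ≠ 0) :
    ∀ᶠ y in nhds x, chord m y ≠ 0 :=
  (continuous_chord hm).continuousAt.eventually_ne h

lemma hasDerivAt_valueKernel (hm : 0 < m) (h : chord m x ≠ 0) :
    HasDerivAt (valueKernel m) (valueKernelDeriv m x) x := by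
  have h1 := ((hasDerivAt_sin x).pow 4).div ((hasDerivAt_chord hm x).pow 4) (pow_ne_zero 4 h)
  refine (h1.congr_of_eventuallyEq ?_).congr_deriv ?_
  · filter_upwards [eventually_chord_ne_zero hm h] with y hy
    simp [valueKernel_eq hm hy]
  · simp only [valueKernelDeriv, Pi.pow_apply]
    field_simp
    push_cast
    ring

lemma hasDerivAt_slopeKernel (hm : 0 < m) (h : chord m x ≠ 0) :
    HasDerivAt (slopeKernel m) (slopeKernelDeriv m x) x := by
  have hm' : (m : ℝ) ≠ 0 := by positivity
  have h1 := (((hasDerivAt_sin x).pow 4).mul (hasDerivAt_cos_div m x)).div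
    ((hasDerivAt_chord hm x).pow 3) (pow_ne_zero 3 h)
  refine (h1.congr_of_eventuallyEq ?_).congr_deriv ?_
  · filter_upwards [eventually_chord_ne_zero hm h] with y hy
    simp [slopeKernel_eq hm hy]
  · simp only [slopeKernelDeriv, Pi.pow_apply, Pi.mul_apply]
    have hs : sin (x / m) = chord m x / m := by rw [chord]; field_simp
    rw [hs]
    field_simp
    push_cast
    ring

lemma hasDerivAt_valueKernelDeriv (hm : 0 < m) (h : chord m x ≠ 0) :
    HasDerivAt (valueKernelDeriv m) (valueKernelDeriv₂ m x) x := by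
  have hm' : (m : ℝ) ≠ 0 := by positivity
  have h1 := (((((hasDerivAt_sin x).pow 3).const_mul 4).mul (hasDerivAt_cos x)).div
    ((hasDerivAt_chord hm x).pow 4) (pow_ne_zero 4 h)).sub
    (((((hasDerivAt_sin x).pow 4).const_mul 4).mul (hasDerivAt_cos_div m x)).div
    ((hasDerivAt_chord hm x).pow 5) (pow_ne_zero 5 h))
  refine HasDerivAt.congr_deriv (f := valueKernelDeriv m) h1 ?_
  simp only [valueKernelDeriv₂, Pi.pow_apply, Pi.mul_apply]
  have hs : sin (x / m) = chord m x / m := by rw [chord]; field_simp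
  rw [hs]
  field_simp
  push_cast
  ring

lemma hasDerivAt_slopeKernelDeriv (hm : 0 < m) (h : chord m x ≠ 0) :
    HasDerivAt (slopeKernelDeriv m) (slopeKernelDeriv₂ m x) x := by
  have hm' : (m : ℝ) ≠ 0 := by positivity
  have hD2 := ((hasDerivAt_chord hm x).pow 2).const_mul ((m : ℝ) ^ 2)
  have h1 := ((((((hasDerivAt_sin x).pow 3).const_mul 4).mul (hasDerivAt_cos x)).mul
    (hasDerivAt_cos_div m x)).div ((hasDerivAt_chord hm x).pow 3) (pow_ne_zero 3 h)).sub
    (((hasDerivAt_sin x).pow 4).mul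
      (((hasDerivAt_const x (1 : ℝ)).div hD2
        (mul_ne_zero (pow_ne_zero 2 hm') (pow_ne_zero 2 h))).add
      ((((hasDerivAt_cos_div m x).pow 2).const_mul 3).div ((hasDerivAt_chord hm x).pow 4)
        (pow_ne_zero 4 h))))
  refine HasDerivAt.congr_deriv (f := slopeKernelDeriv m) h1 ?_
  simp only [slopeKernelDeriv₂, Pi.pow_apply, Pi.mul_apply, Pi.add_apply, Pi.div_apply]
  have hs : sin (x / m) = chord m x / m := by rw [chord]; field_simp
  rw [hs]
  field_simp
  push_cast
  ring

lemma dirichlet_add_period (hm : 0 < m) (x : ℝ) :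
    dirichlet m (x + m * π) = -(-1) ^ m * dirichlet m x := by
  obtain ⟨k, rfl⟩ : ∃ k, m = k + 1 := ⟨m - 1, by lia⟩
  have hm' : ((k + 1 : ℕ) : ℝ) ≠ 0 := by positivity
  rw [dirichlet, dirichlet, show (x + (k + 1 : ℕ) * π) / (k + 1 : ℕ) = x / (k + 1 : ℕ) + π by
    field_simp, cos_add_pi, show ((k + 1 : ℕ) : ℤ) - 1 = k by push_cast; ring,
    Chebyshev.U_eval_neg]
  simp [pow_succ, mul_div_assoc]

lemma valueKernel_periodic (hm : 0 < m) : Function.Periodic (valueKernel m) (m * π) := by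
  intro x
  rw [valueKernel, valueKernel, dirichlet_add_period hm, mul_pow]
  rcases neg_one_pow_eq_or ℝ m with h | h <;> rw [h] <;> norm_num

lemma slopeKernel_periodic (hm : 0 < m) : Function.Periodic (slopeKernel m) (m * π) := by
  intro x
  have hm' : (m : ℝ) ≠ 0 := by positivity
  rw [slopeKernel, slopeKernel, dirichlet_add_period hm, mul_pow, sin_add_nat_mul_pi,
    show (x + m * π) / m = x / m + π by field_simp, cos_add_pi]
  rcases neg_one_pow_eq_or ℝ m with h | h <;> rw [h] <;> ring

/-! ### Bounds for the kernels in terms of the chord -/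

lemma abs_sin_pow_three_mul_cos_le (x : ℝ) : |sin x ^ 3 * cos x| ≤ 0.325 := by
  apply abs_le_of_sq_le_sq _ (by norm_num)
  have h : cos x ^ 2 = 1 - sin x ^ 2 := by rw [← sin_sq_add_cos_sq x]; ring
  have h0 := sq_nonneg (sin x)
  rw [show (sin x ^ 3 * cos x) ^ 2 = (sin x ^ 2) ^ 3 * cos x ^ 2 by ring, h]
  generalize sin x ^ 2 = p at *
  -- the maximum of `p ^ 3 (1 - p)` is `27 / 256`, at `p = 3 / 4`
  nlinarith [mul_nonneg (sq_nonneg (p - 3 / 4)) (by positivity : 0 ≤ p ^ 2 + p / 2 + 3 / 16)]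

lemma abs_sin_cos_quartic_le (x : ℝ) :
    |12 * sin x ^ 2 * cos x ^ 2 - 4 * sin x ^ 4| ≤ 4 := by
  have h : cos x ^ 2 = 1 - sin x ^ 2 := by rw [← sin_sq_add_cos_sq x]; ring
  have h0 := sq_nonneg (sin x)
  have h1 := sin_sq_le_one x
  rw [h, abs_le]
  constructor <;> nlinarith [sq_nonneg (sin x ^ 2 - 3 / 8)]

lemma abs_sin_pow_le_one (x : ℝ) (n : ℕ) : |sin x ^ n| ≤ 1 := by
  rw [abs_pow]; exact pow_le_one₀ (abs_nonneg _) (abs_sin_le_one x)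

lemma abs_cos_pow_le_one (x : ℝ) (n : ℕ) : |cos x ^ n| ≤ 1 := by
  rw [abs_pow]; exact pow_le_one₀ (abs_nonneg _) (abs_cos_le_one x)

lemma valueKernel_nonneg (m : ℕ) (x : ℝ) : 0 ≤ valueKernel m x := by
  unfold valueKernel; positivity

lemma inv_chord_pow_le (ht : |chord m x|⁻¹ ≤ t) (n : ℕ) : |(chord m x ^ n)⁻¹| ≤ t ^ n := by
  rw [abs_inv, abs_pow, ← inv_pow]
  exact pow_le_pow_left₀ (by positivity) ht n

lemma abs_mul_le_of_le {a b A B : ℝ} (ha : |a| ≤ A) (hb : |b| ≤ B) : |a * b| ≤ A * B := by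
  rw [abs_mul]
  exact mul_le_mul ha hb (abs_nonneg _) ((abs_nonneg _).trans ha)

lemma abs_valueKernel_le (hm : 0 < m) (h : chord m x ≠ 0) (ht : |chord m x|⁻¹ ≤ t) :
    |valueKernel m x| ≤ t ^ 4 := by
  rw [valueKernel_eq hm h, div_eq_mul_inv]
  simpa using abs_mul_le_of_le (abs_sin_pow_le_one x 4) (inv_chord_pow_le ht 4)

lemma abs_slopeKernel_le (hm : 0 < m) (h : chord m x ≠ 0) (ht : |chord m x|⁻¹ ≤ t) :
    |slopeKernel m x| ≤ t ^ 3 := by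
  rw [slopeKernel_eq hm h, div_eq_mul_inv]
  simpa using abs_mul_le_of_le (abs_mul_le_of_le (abs_sin_pow_le_one x 4) (abs_cos_le_one (x / m)))
    (inv_chord_pow_le ht 3)

lemma abs_valueKernelDeriv_le (ht : |chord m x|⁻¹ ≤ t) :
    |valueKernelDeriv m x| ≤ 1.3 * t ^ 4 + 4 * t ^ 5 := by
  have h1 := abs_mul_le_of_le (abs_sin_pow_three_mul_cos_le x) (inv_chord_pow_le ht 4)
  have h2 := abs_mul_le_of_le (abs_mul_le_of_le (abs_sin_pow_le_one x 4)
    (abs_cos_le_one (x / m))) (inv_chord_pow_le ht 5)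
  rw [valueKernelDeriv]
  rw [abs_le] at *
  simp only [div_eq_mul_inv] at *
  constructor <;> linarith [h1.1, h1.2, h2.1, h2.2]

lemma abs_slopeKernelDeriv_le (ht : |chord m x|⁻¹ ≤ t) :
    |slopeKernelDeriv m x| ≤ 1.3 * t ^ 3 + 1 / m ^ 2 * t ^ 2 + 3 * t ^ 4 := by
  have hmm : |(1 : ℝ) / m ^ 2| ≤ 1 / m ^ 2 := (abs_of_nonneg (by positivity)).le
  have h1 := abs_mul_le_of_le (abs_mul_le_of_le (abs_sin_pow_three_mul_cos_le x)
    (abs_cos_le_one (x / m))) (inv_chord_pow_le ht 3)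
  have h2 := abs_mul_le_of_le (abs_sin_pow_le_one x 4)
    (abs_mul_le_of_le hmm (inv_chord_pow_le ht 2))
  have h3 := abs_mul_le_of_le (abs_sin_pow_le_one x 4)
    (abs_mul_le_of_le (abs_cos_pow_le_one (x / m) 2) (inv_chord_pow_le ht 4))
  rw [slopeKernelDeriv]
  rw [abs_le] at *
  simp only [div_eq_mul_inv, mul_inv] at *
  constructor <;> linarith [h1.1, h1.2, h2.1, h2.2, h3.1, h3.2]

lemma abs_valueKernelDeriv₂_le (ht : |chord m x|⁻¹ ≤ t) :
    |valueKernelDeriv₂ m x| ≤ 4 * t ^ 4 + 10.4 * t ^ 5 + 20 * t ^ 6 + 4 / m ^ 2 * t ^ 4 := by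
  have hmm : |(1 : ℝ) / m ^ 2| ≤ 1 / m ^ 2 := (abs_of_nonneg (by positivity)).le
  have h1 := abs_mul_le_of_le (abs_sin_cos_quartic_le x) (inv_chord_pow_le ht 4)
  have h2 := abs_mul_le_of_le (abs_mul_le_of_le (abs_sin_pow_three_mul_cos_le x)
    (abs_cos_le_one (x / m))) (inv_chord_pow_le ht 5)
  have h3 := abs_mul_le_of_le (abs_sin_pow_le_one x 4)
    (abs_mul_le_of_le (abs_cos_pow_le_one (x / m) 2) (inv_chord_pow_le ht 6))
  have h4 := abs_mul_le_of_le (abs_sin_pow_le_one x 4)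
    (abs_mul_le_of_le hmm (inv_chord_pow_le ht 4))
  rw [valueKernelDeriv₂]
  rw [abs_le] at *
  simp only [div_eq_mul_inv, mul_inv] at *
  constructor <;> linarith [h1.1, h1.2, h2.1, h2.2, h3.1, h3.2, h4.1, h4.2]

lemma abs_slopeKernelDeriv₂_le (ht : |chord m x|⁻¹ ≤ t) :
    |slopeKernelDeriv₂ m x| ≤ 4 * t ^ 3 + 2.6 * (1 / m ^ 2 * t ^ 2 + 3 * t ^ 4) +
      8 / m ^ 2 * t ^ 3 + 12 * t ^ 5 := by
  have hmm : |(1 : ℝ) / m ^ 2| ≤ 1 / m ^ 2 := (abs_of_nonneg (by positivity)).le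
  have h1 := abs_mul_le_of_le (abs_mul_le_of_le (abs_sin_cos_quartic_le x)
    (abs_cos_le_one (x / m))) (inv_chord_pow_le ht 3)
  have h2 := abs_mul_le_of_le (abs_sin_pow_three_mul_cos_le x)
    (abs_mul_le_of_le hmm (inv_chord_pow_le ht 2))
  have h3 := abs_mul_le_of_le (abs_sin_pow_three_mul_cos_le x)
    (abs_mul_le_of_le (abs_cos_pow_le_one (x / m) 2) (inv_chord_pow_le ht 4))
  have h4 := abs_mul_le_of_le (abs_sin_pow_le_one x 4)
    (abs_mul_le_of_le (abs_mul_le_of_le (abs_cos_le_one (x / m)) hmm) (inv_chord_pow_le ht 3))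
  have h5 := abs_mul_le_of_le (abs_sin_pow_le_one x 4)
    (abs_mul_le_of_le (abs_cos_pow_le_one (x / m) 3) (inv_chord_pow_le ht 5))
  rw [slopeKernelDeriv₂]
  rw [abs_le] at *
  simp only [div_eq_mul_inv, mul_inv] at *
  constructor <;> linarith [h1.1, h1.2, h2.1, h2.2, h3.1, h3.2, h4.1, h4.2, h5.1, h5.2]

/-! ### The kernels near the origin -/

lemma sin_le_taylor_five (hx : 0 ≤ x) : sin x ≤ x - x ^ 3 / 6 + x ^ 5 / 120 := by
  have hcos : ∀ y : ℝ, 0 ≤ y → cos y ≤ 1 - y ^ 2 / 2 + y ^ 4 / 24 := by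
    have hd : ∀ y : ℝ, HasDerivAt (fun y => 1 - y ^ 2 / 2 + y ^ 4 / 24 - cos y)
        (-(y - y ^ 3 / 6 - sin y)) y := by
      intro y
      have := ((((hasDerivAt_id y).pow 2).div_const 2).const_sub 1).add
        (((hasDerivAt_id y).pow 4).div_const 24) |>.sub (hasDerivAt_cos y)
      refine this.congr_deriv ?_
      simp; ring
    have hmono : MonotoneOn (fun y => 1 - y ^ 2 / 2 + y ^ 4 / 24 - cos y) (Set.Ici (0 : ℝ)) := by
      apply monotoneOn_of_deriv_nonneg (convex_Ici 0)
        (fun y _ => (hd y).continuousAt.continuousWithinAt)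
        (fun y _ => (hd y).differentiableAt.differentiableWithinAt)
      intro y hy
      rw [interior_Ici] at hy
      rw [(hd y).deriv]
      linarith [sin_ge_sub_cube (le_of_lt hy)]
    intro y hy
    have := hmono (Set.mem_Ici.2 le_rfl) hy hy
    simp at this
    linarith
  have hd : ∀ y : ℝ, HasDerivAt (fun y => y - y ^ 3 / 6 + y ^ 5 / 120 - sin y)
      (1 - y ^ 2 / 2 + y ^ 4 / 24 - cos y) y := by
    intro y
    have := ((hasDerivAt_id y).sub (((hasDerivAt_id y).pow 3).div_const 6)).add
      (((hasDerivAt_id y).pow 5).div_const 120) |>.sub (hasDerivAt_sin y)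
    refine this.congr_deriv ?_
    simp; ring
  have hmono : MonotoneOn (fun y => y - y ^ 3 / 6 + y ^ 5 / 120 - sin y) (Set.Ici (0 : ℝ)) := by
    apply monotoneOn_of_deriv_nonneg (convex_Ici 0)
      (fun y _ => (hd y).continuousAt.continuousWithinAt)
      (fun y _ => (hd y).differentiableAt.differentiableWithinAt)
    intro y hy
    rw [interior_Ici] at hy
    rw [(hd y).deriv]
    linarith [hcos y (le_of_lt hy)]
  have := hmono (Set.mem_Ici.2 le_rfl) hx hx
  simp at this
  linarith

lemma dirichlet_neg (m : ℕ) (x : ℝ) : dirichlet m (-x) = dirichlet m x := by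
  simp [dirichlet, neg_div]

lemma chord_ge_near (hm : 64 ≤ m) (hx : 0 ≤ x) : x * (1 - x ^ 2 / 24576) ≤ chord m x := by
  have hm0 : (64 : ℝ) ≤ m := by exact_mod_cast hm
  have hm1 : (0 : ℝ) < m := by linarith
  have h := sin_ge_sub_cube (x := x / m) (by positivity)
  have h2 : m * (x / m - (x / m) ^ 3 / 6) ≤ chord m x := mul_le_mul_of_nonneg_left h hm1.le
  have h3 : m * (x / m - (x / m) ^ 3 / 6) = x * (1 - (x / m) ^ 2 / 6) := by
    field_simp
  have h4 : (x / m) ^ 2 ≤ x ^ 2 / 4096 := by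
    calc (x / m) ^ 2 ≤ (x / 64) ^ 2 := by gcongr
      _ = x ^ 2 / 4096 := by ring
  nlinarith

lemma chord_le (m : ℕ) (hx : 0 ≤ x) : chord m x ≤ x := by
  rcases Nat.eq_zero_or_pos m with rfl | hm
  · simpa [chord]
  have hm1 : (0 : ℝ) < m := by positivity
  calc chord m x ≤ m * (x / m) := mul_le_mul_of_nonneg_left (sin_le (by positivity)) hm1.le
    _ = x := by field_simp

/-- On `(0, 1.6]` the Dirichlet kernel is bounded by the Taylor polynomial of `sin x / x`. -/
lemma dirichlet_le_taylor (hm : 64 ≤ m) (hx : 0 < x) (hx' : x ≤ 1.6) :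
    dirichlet m x * (1 - x ^ 2 / 24576) ≤ 1 - x ^ 2 / 6 + x ^ 4 / 120 := by
  have h1 := chord_ge_near hm hx.le
  have hb : 0 < 1 - x ^ 2 / 24576 := by nlinarith
  have h0 : 0 < chord m x := lt_of_lt_of_le (by positivity) h1
  have h2 := sin_le_taylor_five hx.le
  rw [dirichlet_eq_div (by lia) h0.ne', div_mul_eq_mul_div, div_le_iff₀ h0]
  have h5 : 0 ≤ 1 - x ^ 2 / 6 + x ^ 4 / 120 := by nlinarith [sq_nonneg (x ^ 2)]
  calc sin x * (1 - x ^ 2 / 24576)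
      ≤ (x - x ^ 3 / 6 + x ^ 5 / 120) * (1 - x ^ 2 / 24576) := by gcongr
    _ = (1 - x ^ 2 / 6 + x ^ 4 / 120) * (x * (1 - x ^ 2 / 24576)) := by ring
    _ ≤ _ := by gcongr

lemma dirichlet_nonneg (hm : 64 ≤ m) (hx : 0 < x) (hx' : x ≤ 1.6) : 0 ≤ dirichlet m x := by
  have h1 := chord_ge_near hm hx.le
  have hb : 0 < 1 - x ^ 2 / 24576 := by nlinarith
  have h0 : 0 < chord m x := lt_of_lt_of_le (by positivity) h1
  rw [dirichlet_eq_div (by lia) h0.ne']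
  have hs0 : 0 ≤ sin x := (sin_pos_of_pos_of_lt_pi hx (by linarith [pi_gt_three])).le
  positivity

lemma dirichlet_le_of_ge {a : ℝ} (hm : 64 ≤ m) (ha : 0 < a) (hax : a ≤ x) (hx' : x ≤ 1.6) :
    0.9998 * dirichlet m x ≤ 1 - a ^ 2 / 6 + a ^ 4 / 120 := by
  have h1 := dirichlet_le_taylor hm (ha.trans_le hax) hx'
  have h2 := dirichlet_nonneg hm (ha.trans_le hax) hx'
  have h3 : a ^ 2 ≤ x ^ 2 := by gcongr
  have h4 : x ^ 2 ≤ 2.56 := by nlinarith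
  nlinarith [mul_nonneg (sub_nonneg.2 h3) (by nlinarith : 0 ≤ 20 - x ^ 2 - a ^ 2),
    mul_nonneg h2 (by nlinarith : 0 ≤ 0.0002 - x ^ 2 / 24576)]

/-- Quadratic decay of the value kernel near its maximum. -/
lemma valueKernel_le_near (hm : 64 ≤ m) (hx : |x| ≤ 0.7) :
    valueKernel m x ≤ 1 - 0.565 * x ^ 2 := by
  wlog hx0 : 0 ≤ x generalizing x
  · have := this (x := -x) (by simpa) (by linarith)
    simpa [valueKernel, dirichlet_neg] using this
  rcases hx0.eq_or_lt with rfl | hpos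
  · simp [valueKernel_zero (show 0 < m by lia)]
  rw [abs_of_nonneg hx0] at hx
  have h1 := dirichlet_le_taylor hm hpos (by linarith)
  have h2 := dirichlet_nonneg hm hpos (by linarith)
  have hy : x ^ 2 ≤ 0.49 := by nlinarith
  have hy0 : 0 ≤ x ^ 2 := by positivity
  have hD : dirichlet m x ≤ 1 - 0.16 * x ^ 2 := by
    rw [show x ^ 4 = (x ^ 2) ^ 2 by ring] at h1
    have hb : 0 < 1 - x ^ 2 / 24576 := by linarith
    rw [← le_div_iff₀ hb] at h1
    refine h1.trans ?_
    rw [div_le_iff₀ hb]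
    nlinarith
  calc valueKernel m x ≤ (1 - 0.16 * x ^ 2) ^ 4 := pow_le_pow_left₀ h2 hD 4
    _ ≤ 1 - 0.565 * x ^ 2 := by
      have hu : (1 - 0.16 * x ^ 2) ^ 2 ≤ 1 - 0.3072 * x ^ 2 := by nlinarith
      have hu0 : 0 ≤ (1 - 0.16 * x ^ 2) ^ 2 := by positivity
      calc (1 - 0.16 * x ^ 2) ^ 4 = ((1 - 0.16 * x ^ 2) ^ 2) ^ 2 := by ring
        _ ≤ (1 - 0.3072 * x ^ 2) ^ 2 := pow_le_pow_left₀ hu0 hu 2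
        _ ≤ _ := by nlinarith

/-- The slope kernel is the identity near the origin, up to a cubic error. -/
lemma abs_slopeKernel_sub_le (hm : 64 ≤ m) (hx : |x| ≤ 0.7) :
    |slopeKernel m x - x| ≤ 0.47 * x ^ 2 := by
  wlog hx0 : 0 ≤ x generalizing x
  · have := this (x := -x) (by simpa) (by linarith)
    rw [← abs_neg]
    simpa [slopeKernel, dirichlet_neg, neg_div, add_comm, sub_eq_add_neg] using this
  rcases hx0.eq_or_lt with rfl | hpos
  · simp [slopeKernel_zero]
  rw [abs_of_nonneg hx0] at hx
  have hm0 : (64 : ℝ) ≤ m := by exact_mod_cast hm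
  have h1 := chord_ge_near hm hx0
  have hb : 0 < 1 - x ^ 2 / 24576 := by nlinarith
  have h0 : 0 < chord m x := lt_of_lt_of_le (by positivity) h1
  have hD0 := dirichlet_nonneg hm hpos (by linarith)
  have hV := valueKernel_le_near hm (x := x) (by rwa [abs_of_nonneg hx0])
  have hD1 : dirichlet m x ≤ 1 := by
    have : dirichlet m x ^ 4 ≤ 1 := by
      have := hV; rw [valueKernel] at this; nlinarith
    exact (pow_le_one_iff_of_nonneg hD0 (by norm_num)).1 this
  have hs0 : 0 ≤ sin x := (sin_pos_of_pos_of_lt_pi hpos (by linarith [pi_gt_three])).le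
  have hy0 : 0 ≤ x ^ 2 := by positivity
  have hy : x ^ 2 ≤ 0.49 := by nlinarith
  have hc : 1 - x ^ 2 / 8192 ≤ cos (x / m) := by
    have := one_sub_sq_div_two_le_cos (x := x / m)
    have h4 : (x / m) ^ 2 ≤ x ^ 2 / 4096 := by
      calc (x / m) ^ 2 ≤ (x / 64) ^ 2 := by gcongr
        _ = x ^ 2 / 4096 := by ring
    linarith
  have hsx : x * (1 - x ^ 2 / 6) ≤ sin x := by
    have := sin_ge_sub_cube hx0; nlinarith
  have hDl : 1 - x ^ 2 / 6 ≤ dirichlet m x := by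
    rw [dirichlet_eq_div (by lia) h0.ne', le_div_iff₀ h0]
    calc (1 - x ^ 2 / 6) * chord m x ≤ (1 - x ^ 2 / 6) * x :=
          mul_le_mul_of_nonneg_left (chord_le m hx0) (by nlinarith)
      _ ≤ sin x := by linarith
  have hup : slopeKernel m x ≤ x := by
    calc slopeKernel m x ≤ 1 * (sin x * 1) :=
          mul_le_mul (pow_le_one₀ hD0 hD1)
            (mul_le_mul_of_nonneg_left (cos_le_one _) hs0)
            (mul_nonneg hs0 (by linarith)) (by norm_num)
      _ ≤ x := by linarith [sin_le hx0]
  have hlow : x * (1 - 0.67 * x ^ 2) ≤ slopeKernel m x := by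
    have hb1 : 0 ≤ 1 - x ^ 2 / 6 := by linarith
    calc x * (1 - 0.67 * x ^ 2)
        ≤ x * ((1 - x ^ 2 / 6) ^ 4 * (1 - x ^ 2 / 8192)) := by
          apply mul_le_mul_of_nonneg_left _ hx0
          have hu : 1 - x ^ 2 / 3 ≤ (1 - x ^ 2 / 6) ^ 2 := by nlinarith
          have hu0 : 0 ≤ 1 - x ^ 2 / 3 := by linarith
          have hv : 1 - 2 / 3 * x ^ 2 ≤ (1 - x ^ 2 / 6) ^ 4 := by
            calc 1 - 2 / 3 * x ^ 2 ≤ (1 - x ^ 2 / 3) ^ 2 := by nlinarith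
              _ ≤ ((1 - x ^ 2 / 6) ^ 2) ^ 2 := pow_le_pow_left₀ hu0 hu 2
              _ = _ := by ring
          calc 1 - 0.67 * x ^ 2 ≤ (1 - 2 / 3 * x ^ 2) * (1 - x ^ 2 / 8192) := by nlinarith
            _ ≤ _ := mul_le_mul_of_nonneg_right hv (by linarith)
      _ = (1 - x ^ 2 / 6) ^ 3 * (x * (1 - x ^ 2 / 6) * (1 - x ^ 2 / 8192)) := by ring
      _ ≤ slopeKernel m x :=
        mul_le_mul (pow_le_pow_left₀ hb1 hDl 3)
          (mul_le_mul hsx hc (by linarith) hs0) (mul_nonneg (by positivity) (by linarith))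
          (by positivity)
  rw [abs_le]
  constructor
  · nlinarith
  · nlinarith

/-- Bounds for the kernels at moderate distance from the origin. -/
lemma abs_kernels_le_of_ge {a ρ : ℝ} (hm : 64 ≤ m) (ha : 0 < a) (hax : a ≤ |x|)
    (hx' : |x| ≤ 1.6) (hρ : 1 - a ^ 2 / 6 + a ^ 4 / 120 ≤ 0.9998 * ρ) :
    |valueKernel m x| ≤ ρ ^ 4 ∧ |slopeKernel m x| ≤ ρ ^ 3 := by
  have hd : dirichlet m x = dirichlet m |x| := by
    rcases abs_choice x with h | h <;> rw [h]
    rw [dirichlet_neg]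
  have h1 := dirichlet_nonneg hm (ha.trans_le hax) hx'
  have h2 := dirichlet_le_of_ge hm ha hax hx'
  have h3 : |dirichlet m x| ≤ ρ := by
    rw [hd, abs_of_nonneg h1]; linarith
  constructor
  · rw [valueKernel, abs_pow]; exact pow_le_pow_left₀ (abs_nonneg _) h3 4
  · rw [slopeKernel]
    have := abs_mul_le_of_le (a := dirichlet m x ^ 3) (A := ρ ^ 3)
      (by rw [abs_pow]; exact pow_le_pow_left₀ (abs_nonneg _) h3 3)
      (abs_mul_le_of_le (abs_sin_le_one x) (abs_cos_le_one (x / m)))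
    simpa using this

end Kernels

/-! ### Sums over separated points -/

/-- An upper bound for `Y / |chord m x|` when `x` is at distance at least `i Y` from the zeros of
`chord m`. It is close to `1 / i` for small `i`; for large `i` the chord may be shorter than the
arc by the factor `2 / π ≥ 0.63`. -/
def chordWeight (i : ℕ) : ℝ := if i ≤ 4 then 1 / (0.9935 * i) else 1 / (0.63 * i)

section Sums

open Real

variable {m : ℕ} {x : ℝ}

lemma chordWeight_nonneg (i : ℕ) : 0 ≤ chordWeight i := by
  unfold chordWeight; split_ifs <;> positivity

lemma chordWeight_le {i : ℕ} (hi : 1 ≤ i) : chordWeight i ≤ 1.007 := by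
  unfold chordWeight
  have : (1 : ℝ) ≤ i := by exact_mod_cast hi
  split_ifs with h
  · rw [div_le_iff₀ (by positivity)]; linarith
  · have : (5 : ℝ) ≤ i := by exact_mod_cast (by lia : 5 ≤ i)
    rw [div_le_iff₀ (by positivity)]; linarith

/-- The partial sums stay below their limits by a margin that telescopes. -/
lemma sum_chordWeight_pow_le_sub (K : ℕ) :
    ∑ i ∈ Finset.Icc 1 (K + 4), chordWeight i ^ 3 ≤ 1.31 - 2 / ((K + 4) * (K + 5)) ∧
    ∑ i ∈ Finset.Icc 1 (K + 4), chordWeight i ^ 4 ≤ 1.14 - 0.635 / ((K + 4) * (K + 5)) := by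
  induction K with
  | zero =>
    have h : Finset.Icc 1 (0 + 4) = {1, 2, 3, 4} := by decide
    rw [h]
    norm_num [chordWeight]
  | succ K ih =>
    have hw : chordWeight (K + 5) = 1 / (0.63 * (K + 5)) := by
      rw [chordWeight, if_neg (by lia)]; push_cast; rfl
    have hK : (0 : ℝ) ≤ K := by positivity
    have hs : ∀ n : ℕ, ∑ i ∈ Finset.Icc 1 (K + 1 + 4), chordWeight i ^ n =
        ∑ i ∈ Finset.Icc 1 (K + 4), chordWeight i ^ n + (1 / (0.63 * (K + 5))) ^ n := fun n => by
      rw [show K + 1 + 4 = (K + 4) + 1 by ring, Finset.sum_Icc_succ_top (by lia),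
        show K + 4 + 1 = K + 5 by ring, hw]
    rw [hs, hs]
    have e1 : (2 : ℝ) / ((K + 4) * (K + 5)) - 2 / ((K + 5) * (K + 6)) =
        4 / ((K + 4) * (K + 5) * (K + 6)) := by field_simp; ring
    have e2 : (0.635 : ℝ) / ((K + 4) * (K + 5)) - 0.635 / ((K + 5) * (K + 6)) =
        1.27 / ((K + 4) * (K + 5) * (K + 6)) := by field_simp; ring
    have h3 : (1 / (0.63 * ((K : ℝ) + 5))) ^ 3 ≤ 4 / ((K + 4) * (K + 5) * (K + 6)) := by
      rw [div_pow, one_pow, mul_pow, div_le_div_iff₀ (by positivity) (by positivity)]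
      nlinarith [pow_nonneg hK 2, pow_nonneg hK 3]
    have h4 : (1 / (0.63 * ((K : ℝ) + 5))) ^ 4 ≤ 1.27 / ((K + 4) * (K + 5) * (K + 6)) := by
      have h5 : 1 / (0.63 * ((K : ℝ) + 5)) ≤ 1.27 / 4 := by
        rw [div_le_div_iff₀ (by positivity) (by positivity)]; linarith
      calc (1 / (0.63 * ((K : ℝ) + 5))) ^ 4
          = (1 / (0.63 * ((K : ℝ) + 5))) ^ 3 * (1 / (0.63 * ((K : ℝ) + 5))) := by ring
        _ ≤ 4 / (((K : ℝ) + 4) * (K + 5) * (K + 6)) * (1.27 / 4) := by gcongr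
        _ = _ := by ring
    push_cast
    rw [show (K : ℝ) + 1 + 4 = K + 5 by ring, show (K : ℝ) + 1 + 5 = K + 6 by ring]
    constructor <;> linarith [ih.1, ih.2]

lemma sum_chordWeight_pow_three_le (K : ℕ) :
    ∑ i ∈ Finset.Icc 1 K, chordWeight i ^ 3 ≤ 1.31 := by
  have h := (sum_chordWeight_pow_le_sub K).1
  have h2 : ∑ i ∈ Finset.Icc 1 K, chordWeight i ^ 3 ≤
      ∑ i ∈ Finset.Icc 1 (K + 4), chordWeight i ^ 3 :=
    Finset.sum_le_sum_of_subset_of_nonneg (Finset.Icc_subset_Icc_right (by lia))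
      fun i _ _ => pow_nonneg (chordWeight_nonneg i) 3
  have : (0 : ℝ) ≤ 2 / ((K + 4) * (K + 5)) := by positivity
  linarith

lemma sum_chordWeight_pow_four_le (K : ℕ) :
    ∑ i ∈ Finset.Icc 1 K, chordWeight i ^ 4 ≤ 1.14 := by
  have h := (sum_chordWeight_pow_le_sub K).2
  have h2 : ∑ i ∈ Finset.Icc 1 K, chordWeight i ^ 4 ≤
      ∑ i ∈ Finset.Icc 1 (K + 4), chordWeight i ^ 4 :=
    Finset.sum_le_sum_of_subset_of_nonneg (Finset.Icc_subset_Icc_right (by lia))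
      fun i _ _ => pow_nonneg (chordWeight_nonneg i) 4
  have : (0 : ℝ) ≤ 0.635 / ((K + 4) * (K + 5)) := by positivity
  linarith

lemma sin_le_sin_of_le_of_add_le_pi {v x : ℝ} (hv : 0 ≤ v) (h1 : v ≤ x) (h2 : x ≤ π - v) :
    sin v ≤ sin x := by
  rcases le_total x (π / 2) with h | h
  · exact sin_le_sin_of_le_of_le_pi_div_two (by linarith) h h1
  · rw [← sin_pi_sub x]
    exact sin_le_sin_of_le_of_le_pi_div_two (by linarith) (by linarith) (by linarith)

lemma abs_chord_eq (m : ℕ) (x : ℝ) : |chord m x| = |chord m (|x|)| := by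
  rcases abs_choice x with h | h <;> rw [h]
  simp [chord, neg_div]

lemma inv_chord_le {Y v : ℝ} {i : ℕ} (hm : 64 ≤ m) (hY : 0 < Y) (hYπ : Y ≤ π) (hi : 1 ≤ i)
    (hv : i * Y ≤ v) (hvx : v ≤ |x|) (hx : |x| ≤ m * π - v) :
    chord m x ≠ 0 ∧ |chord m x|⁻¹ ≤ chordWeight i / Y := by
  have hm0 : (64 : ℝ) ≤ m := by exact_mod_cast hm
  have hm1 : (0 : ℝ) < m := by linarith
  have hi1 : (1 : ℝ) ≤ i := by exact_mod_cast hi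
  have hiY : 0 < i * Y := by positivity
  have hv0 : 0 < v := hiY.trans_le hv
  have hvm : v / m ≤ π / 2 := by rw [div_le_iff₀ hm1]; linarith
  have h1 : chord m v ≤ |chord m x| := by
    rw [abs_chord_eq]
    refine le_trans ?_ (le_abs_self _)
    apply mul_le_mul_of_nonneg_left _ hm1.le
    apply sin_le_sin_of_le_of_add_le_pi (by positivity)
    · gcongr
    · rw [div_le_iff₀ hm1, sub_mul, div_mul_cancel₀ _ hm1.ne']; linarith
  suffices h : 0 < chordWeight i ∧ Y / chordWeight i ≤ chord m v by
    have h3 : 0 < Y / chordWeight i := div_pos hY h.1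
    have h4 : Y / chordWeight i ≤ |chord m x| := h.2.trans h1
    refine ⟨fun h0 => ?_, ?_⟩
    · rw [h0, abs_zero] at h4; linarith
    · rw [← inv_div]; exact inv_anti₀ h3 h4
  rw [chordWeight]
  split_ifs with h4
  · refine ⟨by positivity, ?_⟩
    have hle : chord m (i * Y) ≤ chord m v := by
      apply mul_le_mul_of_nonneg_left _ hm1.le
      apply sin_le_sin_of_le_of_le_pi_div_two _ hvm (by gcongr)
      have : 0 ≤ i * Y / m := by positivity
      linarith [pi_pos]
    refine le_trans ?_ ((chord_ge_near hm hiY.le).trans hle)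
    have hi4 : (i : ℝ) ≤ 4 := by exact_mod_cast h4
    have h5 : i * Y ≤ 4 * 3.1416 :=
      mul_le_mul hi4 (hYπ.trans pi_lt_d4.le) hY.le (by norm_num)
    have h6 : (i * Y) ^ 2 ≤ 158 := by nlinarith
    have h7 : Y / (1 / (0.9935 * i)) = i * Y * 0.9935 := by field_simp
    rw [h7]
    apply mul_le_mul_of_nonneg_left _ hiY.le
    linarith
  · refine ⟨by positivity, ?_⟩
    have h5 : 2 / π * (v / m) ≤ sin (v / m) := mul_le_sin (by positivity) hvm
    have h6 : (0.63 : ℝ) ≤ 2 / π := by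
      rw [le_div_iff₀ pi_pos]; linarith [pi_lt_d4]
    calc Y / (1 / (0.63 * i)) = 0.63 * (i * Y) := by field_simp
      _ ≤ 2 / π * v := mul_le_mul h6 hv hiY.le (by positivity)
      _ = m * (2 / π * (v / m)) := by field_simp
      _ ≤ chord m v := mul_le_mul_of_nonneg_left h5 hm1.le

/-- Comparison of a sum over `π`-separated nonnegative points with a sum over an arithmetic
progression: the points in `[i π - d, (i + 1) π - d)` are at most one for each `i`. -/
lemma sum_le_of_separated_of_nonneg {κ : Type*} (F : Finset κ) (p g : κ → ℝ) (h : ℕ → ℝ)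
    {d C : ℝ} (hsep : ∀ k ∈ F, ∀ l ∈ F, k ≠ l → π ≤ |p k - p l|)
    (hp : ∀ k ∈ F, π - d ≤ p k) (h0 : ∀ i, 0 ≤ h i)
    (hg : ∀ k ∈ F, ∀ i : ℕ, 1 ≤ i → i * π - d ≤ p k → g k ≤ h i)
    (hC : ∀ K, ∑ i ∈ Finset.Icc 1 K, h i ≤ C) : ∑ k ∈ F, g k ≤ C := by
  classical
  have hle : ∀ k ∈ F, (1 : ℝ) ≤ (p k + d) / π := fun k hk => by
    rw [le_div_iff₀ pi_pos]; linarith [hp k hk]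
  have hfl : ∀ k ∈ F, (⌊(p k + d) / π⌋₊ : ℝ) * π - d ≤ p k := fun k hk => by
    have := Nat.floor_le (zero_le_one.trans (hle k hk))
    rw [le_div_iff₀ pi_pos] at this
    linarith
  have hfl' : ∀ k ∈ F, p k < (⌊(p k + d) / π⌋₊ : ℝ) * π - d + π := fun k hk => by
    have := Nat.lt_floor_add_one ((p k + d) / π)
    rw [div_lt_iff₀ pi_pos] at this
    linarith
  have hone : ∀ k ∈ F, 1 ≤ ⌊(p k + d) / π⌋₊ := fun k hk => by
    rw [Nat.one_le_floor_iff]; exact hle k hk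
  have hinj : Set.InjOn (fun k => ⌊(p k + d) / π⌋₊) F := by
    intro k hk l hl hkl
    by_contra hne
    have hs := hsep k hk l hl hne
    have h1 := hfl k hk
    have h2 := hfl' k hk
    have h3 := hfl l hl
    have h4 := hfl' l hl
    simp only at hkl
    rw [hkl] at h1 h2
    rcases abs_cases (p k - p l) with h | h <;> linarith
  calc ∑ k ∈ F, g k ≤ ∑ k ∈ F, h ⌊(p k + d) / π⌋₊ :=
        Finset.sum_le_sum fun k hk => hg k hk _ (hone k hk) (hfl k hk)
    _ = ∑ i ∈ F.image fun k => ⌊(p k + d) / π⌋₊, h i := (Finset.sum_image hinj).symm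
    _ ≤ ∑ i ∈ Finset.Icc 1 (F.sup fun k => ⌊(p k + d) / π⌋₊), h i := by
        apply Finset.sum_le_sum_of_subset_of_nonneg
        · intro i hi
          obtain ⟨k, hk, rfl⟩ := Finset.mem_image.1 hi
          exact Finset.mem_Icc.2 ⟨hone k hk, Finset.le_sup (f := fun k => ⌊(p k + d) / π⌋₊) hk⟩
        · exact fun i _ _ => h0 i
    _ ≤ C := hC _

lemma sum_le_of_separated {κ : Type*} (F : Finset κ) (p g : κ → ℝ) (h : ℕ → ℝ)
    {d C : ℝ} (hsep : ∀ k ∈ F, ∀ l ∈ F, k ≠ l → π ≤ |p k - p l|)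
    (hp : ∀ k ∈ F, π - d ≤ |p k|) (h0 : ∀ i, 0 ≤ h i)
    (hg : ∀ k ∈ F, ∀ i : ℕ, 1 ≤ i → i * π - d ≤ |p k| → g k ≤ h i)
    (hC : ∀ K, ∑ i ∈ Finset.Icc 1 K, h i ≤ C) : ∑ k ∈ F, g k ≤ 2 * C := by
  classical
  rw [← Finset.sum_filter_add_sum_filter_not F (fun k => 0 ≤ p k), two_mul]
  refine add_le_add
    (sum_le_of_separated_of_nonneg _ p g h (d := d) ?_ ?_ h0 ?_ hC)
    (sum_le_of_separated_of_nonneg _ (fun k => -p k) g h (d := d) ?_ ?_ h0 ?_ hC)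
  · exact fun k hk l hl => hsep k (Finset.mem_filter.1 hk).1 l (Finset.mem_filter.1 hl).1
  · intro k hk
    have := hp k (Finset.mem_filter.1 hk).1
    rwa [abs_of_nonneg (Finset.mem_filter.1 hk).2] at this
  · intro k hk
    have := hg k (Finset.mem_filter.1 hk).1
    rwa [abs_of_nonneg (Finset.mem_filter.1 hk).2] at this
  · intro k hk l hl hkl
    have := hsep k (Finset.mem_filter.1 hk).1 l (Finset.mem_filter.1 hl).1 hkl
    rwa [show -p k - -p l = -(p k - p l) by ring, abs_neg]
  · intro k hk
    have := hp k (Finset.mem_filter.1 hk).1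
    rwa [abs_of_neg (not_le.1 (Finset.mem_filter.1 hk).2)] at this
  · intro k hk
    have := hg k (Finset.mem_filter.1 hk).1
    rwa [abs_of_neg (not_le.1 (Finset.mem_filter.1 hk).2)] at this

/-- A sum over separated points of quantities controlled by the inverse chord, where each point may
be moved by up to `δ`. -/
lemma sum_le_of_inv_chord {κ : Type*} (F : Finset κ) (p g : κ → ℝ) {d δ Y A₃ A₄ : ℝ}
    (hm : 64 ≤ m) (hd : 0 ≤ d) (hδ : 0 ≤ δ) (hY : 0 < Y) (hYd : Y ≤ π - d - δ)
    (hA₃ : 0 ≤ A₃) (hA₄ : 0 ≤ A₄)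
    (hsep : ∀ k ∈ F, ∀ l ∈ F, k ≠ l → π ≤ |p k - p l|)
    (hp : ∀ k ∈ F, π - d ≤ |p k|) (hpm : ∀ k ∈ F, |p k| ≤ m * π / 2)
    (hg : ∀ k ∈ F, ∀ t, 0 ≤ t → t ≤ 1.007 / Y →
      (∀ x, |x - p k| ≤ δ → chord m x ≠ 0 ∧ |chord m x|⁻¹ ≤ t) → g k ≤ A₃ * t ^ 3 + A₄ * t ^ 4) :
    ∑ k ∈ F, g k ≤ 2 * (A₃ * (1.31 / Y ^ 3) + A₄ * (1.14 / Y ^ 4)) := by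
  have hw := chordWeight_nonneg
  refine sum_le_of_separated F p g
    (fun i => A₃ * (chordWeight i / Y) ^ 3 + A₄ * (chordWeight i / Y) ^ 4) (d := d) hsep hp
    (fun i => ?_) (fun k hk i hi hik => ?_) (fun K => ?_)
  · have := hw i
    positivity
  · refine hg k hk _ (div_nonneg (hw i) hY.le) (by gcongr; exact chordWeight_le hi) fun x hx => ?_
    have h1 := abs_sub_abs_le_abs_sub x (p k)
    have h2 := abs_sub_abs_le_abs_sub (p k) x
    rw [abs_sub_comm] at h2
    have hi1 : (1 : ℝ) ≤ i := by exact_mod_cast hi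
    refine inv_chord_le (v := |p k| - δ) hm hY (by linarith) hi ?_ (by linarith) ?_
    · nlinarith
    · have := hpm k hk
      linarith
  · simp only [div_pow]
    rw [Finset.sum_add_distrib, ← Finset.mul_sum, ← Finset.mul_sum, ← Finset.sum_div,
      ← Finset.sum_div]
    gcongr
    · exact sum_chordWeight_pow_three_le K
    · exact sum_chordWeight_pow_four_le K

end Sums

/-! ### Taylor remainders and tails -/

section Interpolation

open Real

/-- Second order Taylor expansion with an explicit remainder. -/
lemma abs_taylor_two_le {g g₁ g₂ : ℝ → ℝ} {p d δ c : ℝ} (hd : |d| ≤ δ)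
    (h₁ : ∀ x, |x - p| ≤ δ → HasDerivAt g (g₁ x) x)
    (h₂ : ∀ x, |x - p| ≤ δ → HasDerivAt g₁ (g₂ x) x)
    (hc : ∀ x, |x - p| ≤ δ → |g₂ x| ≤ c) :
    |g (d + p) - g p - d * g₁ p| ≤ c * (d ^ 2 / 2) := by
  have hseg : ∀ t ∈ Set.Icc (0 : ℝ) 1, |(t * d + p) - p| ≤ δ := fun t ht => by
    rw [add_sub_cancel_right, abs_mul, abs_of_nonneg ht.1]
    exact (mul_le_of_le_one_left (abs_nonneg d) ht.2).trans hd
  have hlip : ∀ t ∈ Set.Icc (0 : ℝ) 1, |g₁ (t * d + p) - g₁ p| ≤ c * (t * |d|) := fun t ht => by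
    have := (convex_Icc (p - δ) (p + δ)).norm_image_sub_le_of_norm_hasDerivWithin_le (f := g₁)
      (f' := g₂) (C := c) (x := p) (y := t * d + p)
      (fun x hx => (h₂ x (abs_le.2 ⟨by linarith [hx.1], by linarith [hx.2]⟩)).hasDerivWithinAt)
      (fun x hx => hc x (abs_le.2 ⟨by linarith [hx.1], by linarith [hx.2]⟩))
      ⟨by linarith [abs_nonneg d], by linarith [abs_nonneg d]⟩
      ⟨by linarith [(abs_le.1 (hseg t ht)).1], by linarith [(abs_le.1 (hseg t ht)).2]⟩
    simpa [abs_mul, abs_of_nonneg ht.1] using this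
  have hf : ∀ t ∈ Set.Icc (0 : ℝ) 1,
      HasDerivAt (fun t => g (t * d + p) - g p - t * (d * g₁ p))
        (d * (g₁ (t * d + p) - g₁ p)) t := fun t ht => by
    have e : HasDerivAt (fun t : ℝ => t * d + p) d t := by
      simpa using ((hasDerivAt_id t).mul_const d).add_const p
    have := (((h₁ _ (hseg t ht)).comp t e).sub_const (g p)).sub
      ((hasDerivAt_id t).mul_const (d * g₁ p))
    refine this.congr_deriv ?_
    ring
  have hB : ∀ t : ℝ, HasDerivAt (fun t => c * (t ^ 2 * (d ^ 2 / 2))) (c * (t * d ^ 2)) t :=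
    fun t => by
      have := (((hasDerivAt_id t).pow 2).mul_const (d ^ 2 / 2)).const_mul c
      refine this.congr_deriv ?_
      simp only [id]
      push_cast
      ring
  have := image_norm_le_of_norm_deriv_right_le_deriv_boundary
    (f := fun t => g (t * d + p) - g p - t * (d * g₁ p)) (a := 0) (b := 1)
    (fun t ht => (hf t ht).continuousAt.continuousWithinAt)
    (fun t ht => (hf t ⟨ht.1, ht.2.le⟩).hasDerivWithinAt) (by simp) hB
    (fun t ht => by
      rw [Real.norm_eq_abs, abs_mul]
      calc |d| * |g₁ (t * d + p) - g₁ p| ≤ |d| * (c * (t * |d|)) := by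
            gcongr; exact hlip t ⟨ht.1, ht.2.le⟩
        _ = c * (t * |d| ^ 2) := by ring
        _ = c * (t * d ^ 2) := by rw [sq_abs])
    (x := 1) (by simp)
  simpa using this

variable {m : ℕ} {ι : Type*}

/-- Every family of points has representatives modulo `m π` of absolute value at most `m π / 2`. -/
lemma exists_reduced (hm : 0 < m) (y : ι → ℝ) (x : ℝ) :
    ∃ n : ι → ℤ, ∀ k, |x - y k + n k * (m * π)| ≤ m * π / 2 := by
  have h0 : 0 < m * π := by positivity
  refine ⟨fun k => -round ((x - y k) / (m * π)), fun k => ?_⟩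
  have h := abs_sub_round ((x - y k) / (m * π))
  have e : x - y k + ((-round ((x - y k) / (m * π)) : ℤ) : ℝ) * (m * π) =
      ((x - y k) / (m * π) - round ((x - y k) / (m * π))) * (m * π) := by
    push_cast
    field_simp
    ring
  rw [e, abs_mul, abs_of_pos h0]
  nlinarith

lemma inv_le_of_inv_chord_le {x t : ℝ} (hm : 0 < m) (h : chord m x ≠ 0)
    (ht : |chord m x|⁻¹ ≤ t) : 1 / (m : ℝ) ≤ t := by
  refine le_trans ?_ ht
  rw [one_div]
  apply inv_anti₀ (abs_pos.2 h)
  rw [chord, abs_mul, abs_of_nonneg (Nat.cast_nonneg m)]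
  exact mul_le_of_le_one_right (by positivity) (abs_sin_le_one _)

/-- The terms of order `1 / m ^ 2` that occur in the derivatives are negligible. -/
lemma one_div_sq_mul_le {t : ℝ} (hm : 64 ≤ m) (ht : 1 / (m : ℝ) ≤ t) :
    1 / (m : ℝ) ^ 2 ≤ 0.0003 ∧ 1 / (m : ℝ) ^ 2 * t ^ 2 ≤ 0.016 * t ^ 3 := by
  have hm0 : (64 : ℝ) ≤ m := by exact_mod_cast hm
  have h1 : 1 / (m : ℝ) ≤ 1 / 64 := by gcongr
  have h0 : 0 < 1 / (m : ℝ) := by positivity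
  have e : 1 / (m : ℝ) ^ 2 = (1 / (m : ℝ)) ^ 2 := by rw [div_pow, one_pow]
  rw [e]
  constructor
  · nlinarith
  · have : (1 / (m : ℝ)) ^ 2 ≤ 0.016 * t := by nlinarith
    nlinarith [sq_nonneg t]

lemma norm_sum_le_mul_add {A B a b : ℝ} {F : Finset ι} {α β : ι → ℂ} {v w : ι → ℝ}
    (hα : ∀ k, ‖α k‖ ≤ A) (hβ : ∀ k, ‖β k‖ ≤ B) (hA : 0 ≤ A) (hB : 0 ≤ B)
    (hv : ∑ k ∈ F, |v k| ≤ a) (hw : ∑ k ∈ F, |w k| ≤ b) :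
    ‖∑ k ∈ F, (α k * v k + β k * w k)‖ ≤ A * a + B * b := by
  calc ‖∑ k ∈ F, (α k * v k + β k * w k)‖
      ≤ ∑ k ∈ F, (A * |v k| + B * |w k|) := by
        refine norm_sum_le_of_le _ fun k _ => (norm_add_le _ _).trans ?_
        rw [norm_mul, norm_mul, Complex.norm_real, Complex.norm_real]
        exact add_le_add (mul_le_mul_of_nonneg_right (hα k) (abs_nonneg _))
          (mul_le_mul_of_nonneg_right (hβ k) (abs_nonneg _))
    _ = A * ∑ k ∈ F, |v k| + B * ∑ k ∈ F, |w k| := by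
        rw [Finset.sum_add_distrib, Finset.mul_sum, Finset.mul_sum]
    _ ≤ _ := by gcongr

section Tails

variable {F : Finset ι} {p : ι → ℝ} {d Y : ℝ}

/-- Total contribution of the kernels centred at separated points. -/
lemma sum_abs_kernels_le (hm : 64 ≤ m) (hd : 0 ≤ d) (hY : 0 < Y) (hYd : Y ≤ π - d)
    (hsep : ∀ k ∈ F, ∀ l ∈ F, k ≠ l → π ≤ |p k - p l|)
    (hp : ∀ k ∈ F, π - d ≤ |p k|) (hpm : ∀ k ∈ F, |p k| ≤ m * π / 2) :
    ∑ k ∈ F, |valueKernel m (p k)| ≤ 2.28 / Y ^ 4 ∧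
      ∑ k ∈ F, |slopeKernel m (p k)| ≤ 2.62 / Y ^ 3 := by
  have hm0 : 0 < m := by lia
  constructor
  · have := sum_le_of_inv_chord F p (fun k => |valueKernel m (p k)|) (δ := 0) (A₃ := 0) (A₄ := 1)
      hm hd le_rfl hY (by linarith) le_rfl zero_le_one hsep hp hpm fun k hk t ht _ hx => by
        obtain ⟨h1, h2⟩ := hx (p k) (by simp)
        simpa using abs_valueKernel_le hm0 h1 h2
    refine this.trans (le_of_eq ?_)
    ring
  · have := sum_le_of_inv_chord F p (fun k => |slopeKernel m (p k)|) (δ := 0) (A₃ := 1) (A₄ := 0)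
      hm hd le_rfl hY (by linarith) zero_le_one le_rfl hsep hp hpm fun k hk t ht _ hx => by
        obtain ⟨h1, h2⟩ := hx (p k) (by simp)
        simpa using abs_slopeKernel_le hm0 h1 h2
    refine this.trans (le_of_eq ?_)
    ring

lemma sum_abs_kernelDerivs_le (hm : 64 ≤ m)
    (hsep : ∀ k ∈ F, ∀ l ∈ F, k ≠ l → π ≤ |p k - p l|)
    (hp : ∀ k ∈ F, π ≤ |p k|) (hpm : ∀ k ∈ F, |p k| ≤ m * π / 2) :
    ∑ k ∈ F, |valueKernelDeriv m (p k)| ≤ 0.061 ∧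
      ∑ k ∈ F, |slopeKernelDeriv m (p k)| ≤ 0.182 := by
  have hm0 : 0 < m := by lia
  have hY : (3.1415 : ℝ) ≤ π - 0 - 0 := by linarith [pi_gt_d4]
  constructor
  · have := sum_le_of_inv_chord F p (fun k => |valueKernelDeriv m (p k)|) (A₃ := 0) (A₄ := 2.5823)
      hm le_rfl le_rfl (by norm_num) hY le_rfl (by norm_num) hsep
      (by simpa using hp) hpm fun k hk t ht ht' hx => by
        obtain ⟨h1, h2⟩ := hx (p k) (by simp)
        refine (abs_valueKernelDeriv_le h2).trans ?_
        have : t ≤ 0.32055 := ht'.trans (by norm_num)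
        have h4 : 0 ≤ t ^ 4 := by positivity
        rw [pow_succ t 4]
        nlinarith
    refine this.trans ?_
    norm_num
  · have := sum_le_of_inv_chord F p (fun k => |slopeKernelDeriv m (p k)|) (A₃ := 1.316) (A₄ := 3)
      hm le_rfl le_rfl (by norm_num) hY (by norm_num) (by norm_num) hsep
      (by simpa using hp) hpm fun k hk t ht ht' hx => by
        obtain ⟨h1, h2⟩ := hx (p k) (by simp)
        refine (abs_slopeKernelDeriv_le h2).trans ?_
        have := (one_div_sq_mul_le hm (inv_le_of_inv_chord_le hm0 h1 h2)).2
        linarith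
    refine this.trans ?_
    norm_num

/-- Second order remainders of the kernels centred at separated points, for a displacement of at
most `0.7`. -/
lemma sum_abs_kernel_remainders_le (hm : 64 ≤ m) (hd : |d| ≤ 0.7)
    (hsep : ∀ k ∈ F, ∀ l ∈ F, k ≠ l → π ≤ |p k - p l|)
    (hp : ∀ k ∈ F, π ≤ |p k|) (hpm : ∀ k ∈ F, |p k| ≤ m * π / 2) :
    ∑ k ∈ F, |valueKernel m (d + p k) - valueKernel m (p k) - d * valueKernelDeriv m (p k)| ≤
        0.38 * d ^ 2 ∧
      ∑ k ∈ F, |slopeKernel m (d + p k) - slopeKernel m (p k) - d * slopeKernelDeriv m (p k)| ≤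
        0.78 * d ^ 2 := by
  have hm0 : 0 < m := by lia
  have hY : (2.4415 : ℝ) ≤ π - 0 - 0.7 := by linarith [pi_gt_d4]
  have hd0 : 0 ≤ d ^ 2 / 2 := by positivity
  constructor
  · have := sum_le_of_inv_chord F p
      (fun k => |valueKernel m (d + p k) - valueKernel m (p k) - d * valueKernelDeriv m (p k)|)
      (A₃ := 0) (A₄ := 11.6937 * (d ^ 2 / 2))
      hm le_rfl (by norm_num) (by norm_num) hY le_rfl (by positivity) hsep
      (by simpa using hp) hpm fun k hk t ht ht' hx => by
        have h := abs_taylor_two_le hd (fun x hx' => hasDerivAt_valueKernel hm0 (hx x hx').1)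
          (fun x hx' => hasDerivAt_valueKernelDeriv hm0 (hx x hx').1)
          (fun x hx' => abs_valueKernelDeriv₂_le (hx x hx').2)
        refine h.trans ?_
        obtain ⟨h1, h2⟩ := hx (p k) (by norm_num)
        have h3 := (one_div_sq_mul_le hm (inv_le_of_inv_chord_le hm0 h1 h2)).1
        have ht1 : t ≤ 0.41246 := ht'.trans (by norm_num)
        have ht2 : t ^ 2 ≤ 0.17013 := by nlinarith
        have h4 : 0 ≤ t ^ 4 := by positivity
        have e1 : t ^ 5 = t ^ 4 * t := by ring
        have e2 : t ^ 6 = t ^ 4 * t ^ 2 := by ring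
        have e3 : (4 : ℝ) / m ^ 2 = 4 * (1 / m ^ 2) := by ring
        rw [zero_mul, zero_add, mul_right_comm, e1, e2, e3]
        apply mul_le_mul_of_nonneg_right _ hd0
        nlinarith [mul_le_mul_of_nonneg_left ht1 h4, mul_le_mul_of_nonneg_left ht2 h4,
          mul_le_mul_of_nonneg_left h3 h4]
    refine this.trans ?_
    norm_num
    nlinarith [sq_nonneg d]
  · have := sum_le_of_inv_chord F p
      (fun k => |slopeKernel m (d + p k) - slopeKernel m (p k) - d * slopeKernelDeriv m (p k)|)
      (A₃ := 4.045 * (d ^ 2 / 2)) (A₄ := 12.75 * (d ^ 2 / 2))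
      hm le_rfl (by norm_num) (by norm_num) hY (by positivity) (by positivity) hsep
      (by simpa using hp) hpm fun k hk t ht ht' hx => by
        have h := abs_taylor_two_le hd (fun x hx' => hasDerivAt_slopeKernel hm0 (hx x hx').1)
          (fun x hx' => hasDerivAt_slopeKernelDeriv hm0 (hx x hx').1)
          (fun x hx' => abs_slopeKernelDeriv₂_le (hx x hx').2)
        refine h.trans ?_
        obtain ⟨h1, h2⟩ := hx (p k) (by norm_num)
        have h3 := one_div_sq_mul_le hm (inv_le_of_inv_chord_le hm0 h1 h2)
        have ht1 : t ≤ 0.41246 := ht'.trans (by norm_num)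
        have h4 : 0 ≤ t ^ 4 := by positivity
        have h5 : 0 ≤ t ^ 3 := by positivity
        have e1 : t ^ 5 = t ^ 4 * t := by ring
        have e3 : (8 : ℝ) / m ^ 2 = 8 * (1 / m ^ 2) := by ring
        rw [mul_right_comm, mul_right_comm (12.75 : ℝ), ← add_mul, e1, e3]
        apply mul_le_mul_of_nonneg_right _ hd0
        nlinarith [mul_le_mul_of_nonneg_left ht1 h4, mul_le_mul_of_nonneg_left h3.1 h5, h3.2]
    refine this.trans ?_
    norm_num
    nlinarith [sq_nonneg d]

end Tails

end Interpolation

/-! ### The trigonometric interpolant -/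

section Certificate

open Real

variable {m : ℕ} {ι : Type*}

/-- Points `y k` that are `π`-separated modulo `m π` have `π`-separated representatives. -/
lemma separated_reduced {y : ι → ℝ}
    (hy : ∀ k l, k ≠ l → ∀ n : ℤ, π ≤ |y k - y l + n * (m * π)|) (x : ℝ) (n : ι → ℤ) {k l : ι}
    (hkl : k ≠ l) :
    π ≤ |(x - y k + n k * (m * π)) - (x - y l + n l * (m * π))| := by
  have := hy l k hkl.symm (n k - n l)
  push_cast at this
  convert this using 2
  ring

/-- An interpolation system which is close to the identity has solutions close to the data. The
coefficient arrays play the roles of the values (`v`, `w`) and the slopes (`v'`, `w'`) of the two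
kernels at the other nodes; the row bounds are those that hold for `π`-separated nodes. -/
lemma exists_interpolation_coeffs [Fintype ι] [DecidableEq ι] (v w v' w' : ι → ι → ℝ)
    (hv : ∀ j, ∑ k ∈ Finset.univ.erase j, |v j k| ≤ 0.0235)
    (hw : ∀ j, ∑ k ∈ Finset.univ.erase j, |w j k| ≤ 0.085)
    (hv' : ∀ j, ∑ k ∈ Finset.univ.erase j, |v' j k| ≤ 0.061)
    (hw' : ∀ j, ∑ k ∈ Finset.univ.erase j, |w' j k| ≤ 0.182)
    (u : ι → ℂ) (hu : ∀ j, ‖u j‖ ≤ 1) :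
    ∃ α β : ι → ℂ, (∀ k, ‖α k‖ ≤ 1.031) ∧ (∀ k, ‖β k‖ ≤ 0.077) ∧ (∀ k, ‖u k - α k‖ ≤ 0.031) ∧
      (∀ j, α j + ∑ k ∈ Finset.univ.erase j, (α k * v j k + β k * w j k) = u j) ∧
      ∀ j, β j + ∑ k ∈ Finset.univ.erase j, (α k * v' j k + β k * w' j k) = 0 := by
  -- a solution is bounded by its right-hand side, hence the system is uniquely solvable
  have key : ∀ (α β u : ι → ℂ),
      (∀ j, α j + ∑ k ∈ Finset.univ.erase j, (α k * v j k + β k * w j k) = u j) →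
      (∀ j, β j + ∑ k ∈ Finset.univ.erase j, (α k * v' j k + β k * w' j k) = 0) →
      ‖α‖ ≤ 1.031 * ‖u‖ ∧ ‖β‖ ≤ 0.077 * ‖u‖ ∧ ‖u - α‖ ≤ 0.031 * ‖u‖ := by
    intro α β u h1 h2
    have hA := norm_nonneg α
    have hB := norm_nonneg β
    have hU := norm_nonneg u
    have e1 : ‖u - α‖ ≤ ‖α‖ * 0.0235 + ‖β‖ * 0.085 := by
      rw [pi_norm_le_iff_of_nonneg (by positivity)]
      intro j
      rw [Pi.sub_apply, ← h1 j, add_sub_cancel_left]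
      exact norm_sum_le_mul_add (norm_le_pi_norm α) (norm_le_pi_norm β) hA hB (hv j) (hw j)
    have e2 : ‖β‖ ≤ ‖α‖ * 0.061 + ‖β‖ * 0.182 := by
      rw [pi_norm_le_iff_of_nonneg (by positivity)]
      intro j
      rw [eq_neg_of_add_eq_zero_left (h2 j), norm_neg]
      exact norm_sum_le_mul_add (norm_le_pi_norm α) (norm_le_pi_norm β) hA hB (hv' j) (hw' j)
    have e3 : ‖α‖ ≤ ‖u‖ + ‖u - α‖ := by
      have := norm_sub_le u (u - α)
      rwa [sub_sub_cancel] at this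
    refine ⟨?_, ?_, ?_⟩ <;> linarith
  let L : (ι → ℂ) × (ι → ℂ) →ₗ[ℂ] (ι → ℂ) × (ι → ℂ) :=
    { toFun := fun z =>
        (fun j => z.1 j + ∑ k ∈ Finset.univ.erase j, (z.1 k * v j k + z.2 k * w j k),
          fun j => z.2 j + ∑ k ∈ Finset.univ.erase j, (z.1 k * v' j k + z.2 k * w' j k))
      map_add' := fun y z => by
        ext j <;>
        simp only [Prod.fst_add, Prod.snd_add, Pi.add_apply, add_mul, Finset.sum_add_distrib] <;>
        ring
      map_smul' := fun c z => by
        ext j <;>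
        simp only [Prod.smul_fst, Prod.smul_snd, Pi.smul_apply, smul_eq_mul, RingHom.id_apply,
          mul_add, Finset.mul_sum, mul_assoc] }
  have hinj : Function.Injective L := by
    rw [injective_iff_map_eq_zero]
    rintro ⟨α, β⟩ h
    have h1 := congrArg Prod.fst h
    have h2 := congrArg Prod.snd h
    obtain ⟨e1, e2, -⟩ := key α β 0 (fun j => congrFun h1 j) (fun j => congrFun h2 j)
    rw [norm_zero, mul_zero] at e1 e2
    rw [norm_le_zero_iff] at e1 e2
    rw [e1, e2]; rfl
  obtain ⟨⟨α, β⟩, h⟩ := (LinearMap.injective_iff_surjective.1 hinj) (u, 0)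
  have h1 : ∀ j, α j + ∑ k ∈ Finset.univ.erase j, (α k * v j k + β k * w j k) = u j :=
    fun j => congrFun (congrArg Prod.fst h) j
  have h2 : ∀ j, β j + ∑ k ∈ Finset.univ.erase j, (α k * v' j k + β k * w' j k) = 0 :=
    fun j => congrFun (congrArg Prod.snd h) j
  obtain ⟨e1, e2, e3⟩ := key α β u h1 h2
  have hU : ‖u‖ ≤ 1 := (pi_norm_le_iff_of_nonneg zero_le_one).2 hu
  refine ⟨α, β, fun k => (norm_le_pi_norm α k).trans (by linarith),
    fun k => (norm_le_pi_norm β k).trans (by linarith),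
    fun k => (norm_le_pi_norm (u - α) k).trans (by linarith), h1, h2⟩

/-- The trigonometric interpolant with coefficients `α` and `β` at the nodes `y`. -/
def interpolant [Fintype ι] (m : ℕ) (y : ι → ℝ) (α β : ι → ℂ) (x : ℝ) : ℂ :=
  ∑ k, (α k * valueKernel m (x - y k) + β k * slopeKernel m (x - y k))

lemma interpolant_eq_of_reduced [Fintype ι] (hm : 0 < m) (y : ι → ℝ) (α β : ι → ℂ) (x : ℝ)
    (n : ι → ℤ) :
    interpolant m y α β x = ∑ k, (α k * valueKernel m (x - y k + n k * (m * π)) +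
      β k * slopeKernel m (x - y k + n k * (m * π))) := by
  refine Finset.sum_congr rfl fun k _ => ?_
  rw [((valueKernel_periodic hm).int_mul (n k)) (x - y k),
    ((slopeKernel_periodic hm).int_mul (n k)) (x - y k)]

/-- Away from the nodes the interpolant is small: the nearest node contributes the most, the others
little by separation. -/
lemma norm_interpolant_lt_one_of_far [Fintype ι] [DecidableEq ι] (hm : 64 ≤ m) {y : ι → ℝ}
    (hy : ∀ k l, k ≠ l → ∀ n : ℤ, π ≤ |y k - y l + n * (m * π)|) {α β : ι → ℂ}
    (hα : ∀ k, ‖α k‖ ≤ 1.031) (hβ : ∀ k, ‖β k‖ ≤ 0.077) {x : ℝ}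
    (hx : ∀ k (n : ℤ), 0.7 ≤ |x - y k + n * (m * π)|) : ‖interpolant m y α β x‖ < 1 := by
  have hm0 : 0 < m := by lia
  obtain ⟨n, hn⟩ := exists_reduced hm0 y x
  rw [interpolant_eq_of_reduced hm0 y α β x n]
  set p : ι → ℝ := fun k => x - y k + n k * (m * π) with hp
  have hsep : ∀ k l, k ≠ l → π ≤ |p k - p l| := fun k l => separated_reduced hy x n
  have hπ := pi_gt_d4
  have hπ' := pi_lt_d4
  change ‖∑ k, (α k * valueKernel m (p k) + β k * slopeKernel m (p k))‖ < 1
  by_cases hfar : ∀ k, π / 2 ≤ |p k|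
  · obtain ⟨h1, h2⟩ := sum_abs_kernels_le (F := Finset.univ) (p := p) (d := π / 2) (Y := 1.57) hm
      (by positivity) (by norm_num) (by linarith) (fun k _ l _ => hsep k l)
      (fun k _ => by linarith [hfar k]) (fun k _ => hn k)
    refine (norm_sum_le_mul_add hα hβ (by norm_num) (by norm_num) h1 h2).trans_lt ?_
    norm_num
  · push Not at hfar
    obtain ⟨j, hj⟩ := hfar
    have hothers : ∀ k ∈ Finset.univ.erase j, π - |p j| ≤ |p k| := fun k hk => by
      have h1 := hsep k j (Finset.ne_of_mem_erase hk)
      have h2 := abs_sub (p k) (p j)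
      linarith
    -- on the range `a ≤ |p j| ≤ b` the kernels at `p j` are at most `ρ ^ 4` and `ρ ^ 3`
    have hrange : ∀ a b ρ Y : ℝ, 0 < a → a ≤ |p j| → |p j| ≤ b → 0 < Y → Y ≤ π - b →
        1 - a ^ 2 / 6 + a ^ 4 / 120 ≤ 0.9998 * ρ →
        ‖∑ k, (α k * valueKernel m (p k) + β k * slopeKernel m (p k))‖ ≤
          1.031 * ρ ^ 4 + 0.077 * ρ ^ 3 +
            (1.031 * (2.28 / Y ^ 4) + 0.077 * (2.62 / Y ^ 3)) := by
      intro a b ρ Y ha haj hbj hY hYb hρ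
      obtain ⟨h1, h2⟩ := sum_abs_kernels_le (F := Finset.univ.erase j) (p := p) (d := |p j|)
        (Y := Y) hm (abs_nonneg _) hY (by linarith) (fun k _ l _ => hsep k l) hothers
        (fun k _ => hn k)
      obtain ⟨h3, h4⟩ := abs_kernels_le_of_ge hm ha haj (by linarith) hρ
      rw [← Finset.add_sum_erase _ _ (Finset.mem_univ j)]
      refine (norm_add_le _ _).trans (add_le_add ?_
        (norm_sum_le_mul_add hα hβ (by norm_num) (by norm_num) h1 h2))
      refine (norm_add_le _ _).trans ?_
      rw [norm_mul, norm_mul, Complex.norm_real, Complex.norm_real]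
      exact add_le_add (mul_le_mul (hα j) h3 (abs_nonneg _) (by norm_num))
        (mul_le_mul (hβ j) h4 (abs_nonneg _) (by norm_num))
    rcases le_total |p j| 1.1 with h | h
    · refine (hrange 0.7 1.1 0.9207 2.0415 (by norm_num) (hx j (n j)) h (by norm_num) (by linarith)
        (by norm_num)).trans_lt ?_
      norm_num
    · refine (hrange 1.1 1.5708 0.811 1.5707 (by norm_num) h (by linarith) (by norm_num)
        (by linarith) (by norm_num)).trans_lt ?_
      norm_num

/-- Near a node `y j` the interpolant stays below `1` in absolute value, because the quadratic
decay of the value kernel dominates the second order remainders of all the other terms. -/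
lemma norm_interpolant_lt_one_of_near [Fintype ι] [DecidableEq ι] (hm : 64 ≤ m) {y : ι → ℝ}
    (hy : ∀ k l, k ≠ l → ∀ n : ℤ, π ≤ |y k - y l + n * (m * π)|) {α β u : ι → ℂ}
    (hα : ∀ k, ‖α k‖ ≤ 1.031) (hβ : ∀ k, ‖β k‖ ≤ 0.077) (hu : ∀ k, ‖u k‖ = 1)
    (huα : ∀ k, ‖u k - α k‖ ≤ 0.031) (j : ι) {n : ι → ℤ}
    (hn : ∀ k, |y j - y k + n k * (m * π)| ≤ m * π / 2)
    (h1 : α j + ∑ k ∈ Finset.univ.erase j, (α k * valueKernel m (y j - y k + n k * (m * π)) +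
      β k * slopeKernel m (y j - y k + n k * (m * π))) = u j)
    (h2 : β j + ∑ k ∈ Finset.univ.erase j, (α k * valueKernelDeriv m (y j - y k + n k * (m * π)) +
      β k * slopeKernelDeriv m (y j - y k + n k * (m * π))) = 0)
    {d : ℝ} (hd0 : d ≠ 0) (hd : |d| ≤ 0.7) : ‖interpolant m y α β (y j + d)‖ < 1 := by
  have hm0 : 0 < m := by lia
  set p : ι → ℝ := fun k => y j - y k + n k * (m * π) with hp
  have hsep : ∀ k l, k ≠ l → π ≤ |p k - p l| := fun k l => separated_reduced hy (y j) n
  have hpj : ∀ k ∈ Finset.univ.erase j, π ≤ |p k| := fun k hk =>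
    hy j k (Finset.ne_of_mem_erase hk).symm (n k)
  obtain ⟨hr, hr'⟩ := sum_abs_kernel_remainders_le (F := Finset.univ.erase j) hm hd
    (fun k _ l _ => hsep k l) hpj (fun k _ => hn k)
  have hR := norm_sum_le_mul_add hα hβ (by norm_num) (by norm_num) hr hr'
  set R := ∑ k ∈ Finset.univ.erase j,
    (α k * (valueKernel m (d + p k) - valueKernel m (p k) - d * valueKernelDeriv m (p k) : ℝ) +
      β k * (slopeKernel m (d + p k) - slopeKernel m (p k) - d * slopeKernelDeriv m (p k) : ℝ))
    with hRdef
  have hexp : interpolant m y α β (y j + d) =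
      u j * (valueKernel m d : ℝ) + (u j - α j) * (1 - valueKernel m d : ℝ) +
        β j * (slopeKernel m d - d : ℝ) + R := by
    have e1 : interpolant m y α β (y j + d) =
        (α j * valueKernel m d + β j * slopeKernel m d) + ∑ k ∈ Finset.univ.erase j,
          (α k * valueKernel m (d + p k) + β k * slopeKernel m (d + p k)) := by
      rw [interpolant, ← Finset.add_sum_erase _ _ (Finset.mem_univ j), add_sub_cancel_left]
      congr 1
      refine Finset.sum_congr rfl fun k _ => ?_
      rw [show d + p k = y j + d - y k + n k * (m * π) by rw [hp]; ring,
        ((valueKernel_periodic hm0).int_mul (n k)) _, ((slopeKernel_periodic hm0).int_mul (n k)) _]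
    have e2 : ∑ k ∈ Finset.univ.erase j,
          (α k * valueKernel m (d + p k) + β k * slopeKernel m (d + p k)) =
        ∑ k ∈ Finset.univ.erase j, (α k * valueKernel m (p k) + β k * slopeKernel m (p k)) +
        d * ∑ k ∈ Finset.univ.erase j,
          (α k * valueKernelDeriv m (p k) + β k * slopeKernelDeriv m (p k)) + R := by
      rw [hRdef, Finset.mul_sum, ← Finset.sum_add_distrib, ← Finset.sum_add_distrib]
      refine Finset.sum_congr rfl fun k _ => ?_
      push_cast
      ring
    rw [e1, e2, eq_sub_of_add_eq' h1, eq_neg_of_add_eq_zero_right h2]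
    push_cast
    ring
  have hV := valueKernel_le_near hm hd
  have hV0 := valueKernel_nonneg m d
  have hS := abs_slopeKernel_sub_le hm hd
  have hd2 : 0 < d ^ 2 := by positivity
  have n1 : ‖u j * (valueKernel m d : ℝ)‖ = valueKernel m d := by
    rw [norm_mul, hu, one_mul, Complex.norm_real, Real.norm_of_nonneg hV0]
  have n2 : ‖(u j - α j) * (1 - valueKernel m d : ℝ)‖ ≤ 0.031 * (1 - valueKernel m d) := by
    rw [norm_mul, Complex.norm_real,
      Real.norm_of_nonneg (by linarith)]
    exact mul_le_mul_of_nonneg_right (huα j) (by linarith)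
  have n3 : ‖β j * (slopeKernel m d - d : ℝ)‖ ≤ 0.077 * (0.47 * d ^ 2) := by
    rw [norm_mul, Complex.norm_real]
    exact mul_le_mul (hβ j) hS (norm_nonneg _) (by norm_num)
  rw [hexp]
  calc _ ≤ valueKernel m d + 0.031 * (1 - valueKernel m d) + 0.077 * (0.47 * d ^ 2) +
        (1.031 * (0.38 * d ^ 2) + 0.077 * (0.78 * d ^ 2)) := by
        refine norm_add_le_of_le (norm_add_le_of_le (norm_add_le_of_le n1.le n2) n3) hR
    _ < 1 := by linarith

/-- Nodes on a circle of length `m π` that are `π`-separated can be interpolated with arbitrary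
unimodular values by an `interpolant` which is smaller than `1` off the nodes. -/
theorem exists_interpolant [Fintype ι] (hm : 64 ≤ m) {y : ι → ℝ}
    (hy : ∀ k l, k ≠ l → ∀ n : ℤ, π ≤ |y k - y l + n * (m * π)|) {u : ι → ℂ}
    (hu : ∀ k, ‖u k‖ = 1) :
    ∃ α β : ι → ℂ, (∀ j (n : ℤ), interpolant m y α β (y j + n * (m * π)) = u j) ∧
      ∀ x, (∀ j (n : ℤ), x ≠ y j + n * (m * π)) → ‖interpolant m y α β x‖ < 1 := by
  classical
  have hm0 : 0 < m := by lia
  choose n hn using fun j => exists_reduced hm0 y (y j)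
  have hp : ∀ j, ∀ k ∈ Finset.univ.erase j, π ≤ |y j - y k + n j k * (m * π)| := fun j k hk =>
    hy j k (Finset.ne_of_mem_erase hk).symm _
  have hsep : ∀ j k l, k ≠ l →
      π ≤ |(y j - y k + n j k * (m * π)) - (y j - y l + n j l * (m * π))| :=
    fun j k l => separated_reduced hy (y j) (n j)
  have hs := fun j => sum_abs_kernels_le (F := Finset.univ.erase j) (d := 0) (Y := 3.1415) hm le_rfl
    (by norm_num) (by linarith [pi_gt_d4]) (fun k _ l _ => hsep j k l)
    (by simpa only [sub_zero] using hp j) (fun k _ => hn j k)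
  have hs' := fun j => sum_abs_kernelDerivs_le (F := Finset.univ.erase j) hm
    (fun k _ l _ => hsep j k l) (hp j) (fun k _ => hn j k)
  obtain ⟨α, β, hα, hβ, huα, h1, h2⟩ := exists_interpolation_coeffs _ _ _ _
    (fun j => (hs j).1.trans (by norm_num)) (fun j => (hs j).2.trans (by norm_num))
    (fun j => (hs' j).1) (fun j => (hs' j).2) u (fun j => (hu j).le)
  have hper : ∀ x (l : ℤ), interpolant m y α β (x + l * (m * π)) = interpolant m y α β x := by
    intro x l
    rw [interpolant_eq_of_reduced hm0 y α β x fun _ => l, interpolant]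
    simp only [add_sub_right_comm]
  refine ⟨α, β, fun j l => ?_, fun x hx => ?_⟩
  · rw [hper, ← h1 j, interpolant_eq_of_reduced hm0 y α β _ (n j),
      ← Finset.add_sum_erase _ _ (Finset.mem_univ j)]
    congr 1
    rw [((valueKernel_periodic hm0).int_mul (n j j)) _, ((slopeKernel_periodic hm0).int_mul _) _]
    simp [valueKernel_zero hm0, slopeKernel_zero]
  · by_cases hfar : ∀ k (l : ℤ), 0.7 ≤ |x - y k + l * (m * π)|
    · exact norm_interpolant_lt_one_of_far hm hy hα hβ hfar
    · push Not at hfar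
      obtain ⟨j, l, hl⟩ := hfar
      have := norm_interpolant_lt_one_of_near hm hy hα hβ hu huα j (hn j) (h1 j) (h2 j)
        (d := x - y j + l * (m * π)) (fun h0 => hx j (-l) (by push_cast; linarith)) hl.le
      rwa [show y j + (x - y j + l * (m * π)) = x + l * (m * π) by ring, hper] at this

end Certificate

/-! ### Trigonometric polynomials and the dual certificate -/

/-- `f` is a linear combination of the exponentials `exp (i k z)` with `|k| ≤ n`, written as
`exp (-i n z)` times a polynomial of degree at most `2 n` in `exp (i z)`. -/
def IsTrigPoly (n : ℕ) (f : ℝ → ℂ) : Prop :=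
  ∃ p : ℂ[X], p.natDegree ≤ 2 * n ∧
    ∀ z : ℝ, f z * Complex.exp (z * Complex.I) ^ n = p.eval (Complex.exp (z * Complex.I))

section TrigPoly

variable {n k : ℕ} {f g : ℝ → ℂ}

lemma isTrigPoly_const (c : ℂ) : IsTrigPoly 0 fun _ => c :=
  ⟨C c, by simp, by simp⟩

lemma IsTrigPoly.mul (hf : IsTrigPoly n f) (hg : IsTrigPoly k g) :
    IsTrigPoly (n + k) fun z => f z * g z := by
  obtain ⟨p, hp, hp'⟩ := hf
  obtain ⟨q, hq, hq'⟩ := hg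
  refine ⟨p * q, natDegree_mul_le.trans (by lia), fun z => ?_⟩
  rw [eval_mul, ← hp', ← hq', pow_add]
  ring

lemma IsTrigPoly.mono (hf : IsTrigPoly n f) (h : n ≤ k) : IsTrigPoly k f := by
  obtain ⟨p, hp, hp'⟩ := hf
  obtain ⟨l, rfl⟩ := Nat.exists_eq_add_of_le h
  refine ⟨p * X ^ l, natDegree_mul_le.trans ?_, fun z => ?_⟩
  · rw [natDegree_X_pow]; lia
  · rw [eval_mul, ← hp', eval_pow, eval_X, pow_add]
    ring

lemma IsTrigPoly.pow (hf : IsTrigPoly n f) (k : ℕ) : IsTrigPoly (k * n) fun z => f z ^ k := by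
  induction k with
  | zero => simpa using isTrigPoly_const 1
  | succ k ih =>
    rw [Nat.succ_mul]
    simpa only [pow_succ] using ih.mul hf

lemma IsTrigPoly.sum {ι : Type*} {s : Finset ι} {f : ι → ℝ → ℂ} (h : ∀ i ∈ s, IsTrigPoly n (f i)) :
    IsTrigPoly n fun z => ∑ i ∈ s, f i z := by
  choose! p hp hp' using h
  refine ⟨∑ i ∈ s, p i, natDegree_sum_le_of_forall_le _ _ hp, fun z => ?_⟩
  rw [eval_finsetSum, Finset.sum_mul]
  exact Finset.sum_congr rfl fun i hi => hp' i hi z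

lemma IsTrigPoly.add (hf : IsTrigPoly n f) (hg : IsTrigPoly n g) :
    IsTrigPoly n fun z => f z + g z := by
  obtain ⟨p, hp, hp'⟩ := hf
  obtain ⟨q, hq, hq'⟩ := hg
  refine ⟨p + q, natDegree_add_le_of_degree_le hp hq, fun z => ?_⟩
  rw [eval_add, ← hp', ← hq', add_mul]

lemma IsTrigPoly.const_mul (c : ℂ) (hf : IsTrigPoly n f) : IsTrigPoly n fun z => c * f z := by
  simpa using (isTrigPoly_const c).mul hf

lemma IsTrigPoly.comp_sub (hf : IsTrigPoly n f) (a : ℝ) : IsTrigPoly n fun z => f (z - a) := by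
  obtain ⟨p, hp, hp'⟩ := hf
  have hinv : Complex.exp (a * Complex.I) * Complex.exp (-a * Complex.I) = 1 := by
    rw [← Complex.exp_add]; simp
  refine ⟨C (Complex.exp (a * Complex.I) ^ n) * p.comp (C (Complex.exp (-a * Complex.I)) * X),
    ?_, fun z => ?_⟩
  · refine (natDegree_C_mul_le _ _).trans (natDegree_comp_le.trans ?_)
    have : (C (Complex.exp (-a * Complex.I)) * X).natDegree ≤ 1 :=
      (natDegree_C_mul_le _ _).trans natDegree_X_le
    nlinarith
  · have e : Complex.exp ((z - a : ℝ) * Complex.I) =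
        Complex.exp (-a * Complex.I) * Complex.exp (z * Complex.I) := by
      rw [← Complex.exp_add]; push_cast; ring_nf
    have := hp' (z - a)
    rw [e, mul_pow] at this
    rw [eval_mul, eval_C, eval_comp, eval_mul, eval_C, eval_X, ← this]
    have hn : Complex.exp (a * Complex.I) ^ n * Complex.exp (-a * Complex.I) ^ n = 1 := by
      rw [← mul_pow, hinv, one_pow]
    linear_combination (-(f (z - a) * Complex.exp (z * Complex.I) ^ n)) * hn

lemma exp_mul_I_mul_exp_neg (z : ℂ) :
    Complex.exp (-z * Complex.I) * Complex.exp (z * Complex.I) = 1 := by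
  rw [← Complex.exp_add]; simp

lemma isTrigPoly_cos : IsTrigPoly 1 fun z => (Real.cos z : ℂ) := by
  refine ⟨C (1 / 2) * (X ^ 2 + 1), ?_, fun z => ?_⟩
  · refine (natDegree_C_mul_le _ _).trans ?_
    exact natDegree_add_le_of_degree_le (natDegree_X_pow_le 2) (by simp)
  · simp only [eval_mul, eval_C, eval_add, eval_pow, eval_X, eval_one, Complex.ofReal_cos,
      Complex.cos]
    linear_combination (1 / 2) * exp_mul_I_mul_exp_neg z

lemma isTrigPoly_sin_nat_mul (m : ℕ) : IsTrigPoly m fun z => (Real.sin (m * z) : ℂ) := by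
  refine ⟨C (-Complex.I / 2) * (X ^ (2 * m) - 1), ?_, fun z => ?_⟩
  · refine (natDegree_C_mul_le _ _).trans ?_
    exact (natDegree_sub_le _ _).trans (by simp)
  · have e1 : Complex.exp (((m : ℝ) * z : ℝ) * Complex.I) = Complex.exp (z * Complex.I) ^ m := by
      rw [← Complex.exp_nat_mul]; push_cast; ring_nf
    simp only [eval_mul, eval_C, eval_sub, eval_pow, eval_X, eval_one, Complex.ofReal_sin,
      Complex.sin]
    have h := exp_mul_I_mul_exp_neg ((m * z : ℝ) : ℂ)
    rw [e1] at h ⊢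
    rw [two_mul m, pow_add]
    linear_combination (Complex.I / 2) * h

lemma isTrigPoly_eval_cos (Q : ℂ[X]) (hQ : Q.natDegree ≤ n) :
    IsTrigPoly n fun z => Q.eval (Real.cos z : ℂ) := by
  have h : ∀ i ∈ Finset.range (n + 1),
      IsTrigPoly n fun z => Q.coeff i * (Real.cos z : ℂ) ^ i := fun i hi =>
    (((isTrigPoly_cos.pow i).mono (by
      rw [Finset.mem_range] at hi; lia)).const_mul _)
  convert IsTrigPoly.sum h using 2 with z
  rw [eval_eq_sum_range' (Nat.lt_succ_of_le hQ)]

/-- The symmetrization of a trigonometric polynomial of degree `2 N` in `z` under `z ↦ -z` and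
`z ↦ z + π` is an algebraic polynomial of degree `N` in `cos (2 z)`. -/
lemma IsTrigPoly.exists_polynomial {N : ℕ} (hf : IsTrigPoly (2 * N) f) :
    ∃ P : ℂ[X], P.natDegree ≤ N ∧ ∀ z : ℝ, P.eval (Real.cos (2 * z) : ℂ) =
      (f z + f (-z) + (f (z + Real.pi) + f (-(z + Real.pi)))) / 4 := by
  obtain ⟨p, hp, hp'⟩ := hf
  have hadd : ∀ z, f z + f (-z) =
      ∑ i ∈ Finset.range (4 * N + 1),
        p.coeff i * (2 * Complex.cos (((i : ℤ) - 2 * N : ℤ) * z)) := by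
    intro z
    have hexp : ∀ w : ℝ, f w = ∑ i ∈ Finset.range (4 * N + 1),
        p.coeff i * Complex.exp (((i : ℤ) - 2 * N : ℤ) * w * Complex.I) := by
      intro w
      have h0 : Complex.exp (w * Complex.I) ^ (2 * N) ≠ 0 := pow_ne_zero _ (Complex.exp_ne_zero _)
      rw [← mul_left_inj' h0, hp' w, eval_eq_sum_range' (n := 4 * N + 1) (by lia), Finset.sum_mul]
      refine Finset.sum_congr rfl fun i _ => ?_
      rw [mul_assoc, ← Complex.exp_nat_mul, ← Complex.exp_nat_mul, ← Complex.exp_add]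
      congr 2
      push_cast
      ring
    rw [hexp, hexp, ← Finset.sum_add_distrib]
    refine Finset.sum_congr rfl fun i _ => ?_
    rw [Complex.two_cos, mul_add]
    push_cast
    ring_nf
  refine ⟨∑ i ∈ Finset.range (4 * N + 1),
    if Even i then C (p.coeff i) * Chebyshev.T ℂ ((i / 2 : ℕ) - N : ℤ) else 0, ?_, fun z => ?_⟩
  · refine natDegree_sum_le_of_forall_le _ _ fun i hi => ?_
    rw [Finset.mem_range] at hi
    split_ifs
    · refine (natDegree_C_mul_le _ _).trans ?_
      rw [Chebyshev.natDegree_T]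
      lia
    · simp
  · rw [eval_finsetSum, hadd, hadd, ← Finset.sum_add_distrib, Finset.sum_div]
    refine Finset.sum_congr rfl fun i _ => ?_
    have hs : Complex.cos (((i : ℤ) - 2 * N : ℤ) * ((z + Real.pi : ℝ) : ℂ)) =
        (-1) ^ i * Complex.cos (((i : ℤ) - 2 * N : ℤ) * z) := by
      have e1 : (((i : ℤ) - 2 * N : ℤ) : ℂ) * ((z + Real.pi : ℝ) : ℂ) =
          ((((i : ℤ) - 2 * N : ℤ) : ℂ) * z) + ((i : ℤ) - 2 * N : ℤ) * Real.pi := by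
        push_cast; ring
      have e2 := Real.cos_add_int_mul_pi ((((i : ℤ) - 2 * N : ℤ) : ℝ) * z) ((i : ℤ) - 2 * N)
      have e3 := congrArg (fun t : ℝ => (t : ℂ)) e2
      rw [zpow_sub₀ (by norm_num), zpow_mul, zpow_natCast] at e3
      rw [e1]
      push_cast at e3 ⊢
      rw [e3]
      norm_num
    rw [hs]
    split_ifs with hi
    · obtain ⟨l, rfl⟩ := hi
      rw [eval_mul, eval_C, Complex.ofReal_cos, Chebyshev.T_complex_cos,
        Even.neg_one_pow ⟨l, rfl⟩, ← two_mul, Nat.mul_div_cancel_left l (by norm_num)]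
      have : ((l : ℤ) - N : ℤ) * ((2 * z : ℝ) : ℂ) = (((2 * l : ℕ) : ℤ) - 2 * N : ℤ) * z := by
        push_cast; ring
      rw [this]
      ring
    · rw [Odd.neg_one_pow (Nat.not_even_iff_odd.1 hi), eval_zero]
      ring

lemma isTrigPoly_valueKernel {m : ℕ} (hm : 0 < m) :
    IsTrigPoly (4 * m - 2) fun z => (valueKernel m (m * z) : ℂ) := by
  have hm' : (m : ℝ) ≠ 0 := by positivity
  have hU : (Chebyshev.U ℂ ((m : ℤ) - 1)).natDegree ≤ m - 1 := by
    rw [Chebyshev.natDegree_U]; lia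
  have h := (((isTrigPoly_eval_cos _ hU).const_mul (1 / (m : ℂ))).pow 4).mono
    (show 4 * (m - 1) ≤ 4 * m - 2 by lia)
  convert h using 2 with z
  rw [valueKernel, dirichlet, mul_div_cancel_left₀ _ hm']
  push_cast
  ring

lemma isTrigPoly_slopeKernel {m : ℕ} (hm : 0 < m) :
    IsTrigPoly (4 * m - 2) fun z => (slopeKernel m (m * z) : ℂ) := by
  have hm' : (m : ℝ) ≠ 0 := by positivity
  have hU : (Chebyshev.U ℂ ((m : ℤ) - 1)).natDegree ≤ m - 1 := by
    rw [Chebyshev.natDegree_U]; lia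
  have h := ((((isTrigPoly_eval_cos _ hU).const_mul (1 / (m : ℂ))).pow 3).mul
    ((isTrigPoly_sin_nat_mul m).mul isTrigPoly_cos)).mono
    (show 3 * (m - 1) + (m + 1) ≤ 4 * m - 2 by lia)
  convert h using 2 with z
  rw [slopeKernel, dirichlet, mul_div_cancel_left₀ _ hm']
  push_cast
  ring

lemma isTrigPoly_interpolant {ι : Type*} [Fintype ι] {m : ℕ} (hm : 0 < m) (y : ι → ℝ)
    (α β : ι → ℂ) : IsTrigPoly (4 * m - 2) fun z => interpolant m y α β (m * z) := by
  have hm' : (m : ℝ) ≠ 0 := by positivity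
  refine IsTrigPoly.sum fun k _ => ?_
  have h1 := ((isTrigPoly_valueKernel hm).comp_sub (y k / m)).const_mul (α k)
  have h2 := ((isTrigPoly_slopeKernel hm).comp_sub (y k / m)).const_mul (β k)
  convert h1.add h2 using 6 <;> field_simp

end TrigPoly

section DualCertificate

open Real

variable {N : ℕ} {ι : Type*} {s : ι → ℝ}

lemma arccos_bounds_of_minSeparated (hN : 2 ≤ N) (hs : MinSeparated N (Set.range s)) (j : ι) :
    2 * π / N ≤ arccos (s j) ∧ arccos (s j) ≤ π - 2 * π / N := by
  have hN0 : (2 : ℝ) ≤ N := by exact_mod_cast hN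
  obtain ⟨h1, h2⟩ := hs.1 ⟨j, rfl⟩
  have h0 : 0 ≤ 2 * π / N := by positivity
  have hπ : 2 * π / N ≤ π := by rw [div_le_iff₀ (by positivity)]; nlinarith [pi_pos]
  constructor
  · have := arccos_le_arccos h2
    rwa [cos_neg, arccos_cos h0 hπ] at this
  · have := arccos_le_arccos h1
    rwa [show -π + 2 * π / N = -(π - 2 * π / N) by ring, cos_neg,
      arccos_cos (by linarith) (by linarith)] at this

/-- The two preimages `± arccos (s j)` of separated points are separated on the circle. -/
lemma circle_separated_of_minSeparated (hN : 2 ≤ N) (hs : MinSeparated N (Set.range s))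
    (hinj : Function.Injective s) {j l : ι} {σ τ : ℤˣ} (hne : (j, σ) ≠ (l, τ)) (n : ℤ) :
    4 * π / N ≤ |(σ : ℤ) * arccos (s j) - (τ : ℤ) * arccos (s l) + n * (2 * π)| := by
  obtain ⟨hj1, hj2⟩ := arccos_bounds_of_minSeparated hN hs j
  obtain ⟨hl1, hl2⟩ := arccos_bounds_of_minSeparated hN hs l
  have e4 : 4 * π / N = 2 * (2 * π / N) := by ring
  have h0 : 0 ≤ 2 * π / N := by positivity
  have key : 4 * π / N ≤ |(σ : ℤ) * arccos (s j) - (τ : ℤ) * arccos (s l)| ∧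
      |(σ : ℤ) * arccos (s j) - (τ : ℤ) * arccos (s l)| ≤ 2 * π - 4 * π / N := by
    have hd : j ≠ l → 4 * π / N ≤ |arccos (s j) - arccos (s l)| := fun h =>
      hs.2 ⟨j, rfl⟩ ⟨l, rfl⟩ (hinj.ne h)
    have hd' : |arccos (s j) - arccos (s l)| ≤ 2 * π - 4 * π / N := by
      rw [abs_le]; constructor <;> linarith
    have hd2 : 4 * π / N ≤ |arccos (s j) + arccos (s l)| ∧
        |arccos (s j) + arccos (s l)| ≤ 2 * π - 4 * π / N := by
      rw [abs_of_nonneg (by linarith)]; constructor <;> linarith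
    rcases Int.units_eq_one_or σ with rfl | rfl <;> rcases Int.units_eq_one_or τ with rfl | rfl
    · simpa using ⟨hd fun h => hne (by rw [h]), hd'⟩
    · simpa using hd2
    · have : ((-1 : ℤˣ) : ℤ) * arccos (s j) - ((1 : ℤˣ) : ℤ) * arccos (s l) =
          -(arccos (s j) + arccos (s l)) := by push_cast; ring
      rw [this, abs_neg]
      exact hd2
    · have : ((-1 : ℤˣ) : ℤ) * arccos (s j) - ((-1 : ℤˣ) : ℤ) * arccos (s l) =
          -(arccos (s j) - arccos (s l)) := by push_cast; ring
      rw [this, abs_neg]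
      exact ⟨hd fun h => hne (by rw [h]), hd'⟩
  obtain ⟨k1, k2⟩ := key
  generalize (σ : ℤ) * arccos (s j) - (τ : ℤ) * arccos (s l) = A at k1 k2
  rcases eq_or_ne n 0 with rfl | hn
  · simpa using k1
  · have h1 : (1 : ℝ) ≤ |(n : ℝ)| := by
      rw [← Int.cast_abs]; exact_mod_cast Int.one_le_abs hn
    have h2 : |(n : ℝ) * (2 * π)| = |(n : ℝ)| * (2 * π) := by
      rw [abs_mul, abs_of_nonneg (show 0 ≤ 2 * π by positivity)]
    have h3 := abs_sub (A + n * (2 * π)) A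
    rw [add_sub_cancel_left, h2] at h3
    nlinarith [pi_pos]

/-- **Dual certificate**: a polynomial of degree at most `N` which takes prescribed unimodular
values at separated points of `[-1, 1]` and is smaller than `1` in absolute value elsewhere. -/
theorem exists_dualCertificate [Fintype ι] (hN : 128 ≤ N) (hs : MinSeparated N (Set.range s))
    (hinj : Function.Injective s) (hsI : ∀ j, s j ∈ I) (u : ι → ℂ) (hu : ∀ j, ‖u j‖ = 1) :
    ∃ P : ℂ[X], P.natDegree ≤ N ∧ (∀ j, P.eval (s j : ℂ) = u j) ∧
      ∀ t ∈ I, t ∉ Set.range s → ‖P.eval (t : ℂ)‖ < 1 := by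
  -- the least `m` with `N ≤ 2 m`, as separation needs; the degree `4 m - 2` is then at most `2 N`
  obtain ⟨m, hm⟩ : ∃ m, m = (N + 1) / 2 := ⟨_, rfl⟩
  have hm64 : 64 ≤ m := by lia
  have hmN : N ≤ 2 * m := by lia
  have hm0 : 0 < m := by lia
  have hmR : (0 : ℝ) < m := by positivity
  have hNR : (0 : ℝ) < N := by exact_mod_cast (by lia : 0 < N)
  have hmNR : (N : ℝ) ≤ 2 * m := by exact_mod_cast hmN
  let y : ι × ℤˣ → ℝ := fun k => m * ((k.2 : ℤ) * arccos (s k.1) / 2)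
  have hy : ∀ k l, k ≠ l → ∀ n : ℤ, π ≤ |y k - y l + n * (m * π)| := by
    rintro ⟨j, σ⟩ ⟨l, τ⟩ hne n
    have h := circle_separated_of_minSeparated (by lia) hs hinj hne n
    have e : y (j, σ) - y (l, τ) + n * (m * π) =
        m / 2 * ((σ : ℤ) * arccos (s j) - (τ : ℤ) * arccos (s l) + n * (2 * π)) := by
      simp only [y]; ring
    rw [e, abs_mul, abs_of_nonneg (by positivity)]
    calc π ≤ m / 2 * (4 * π / N) := by
          rw [mul_div_assoc', le_div_iff₀ hNR]
          nlinarith [pi_pos]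
      _ ≤ _ := by gcongr
  obtain ⟨α, β, h1, h2⟩ := exists_interpolant hm64 hy (u := fun k => u k.1) (fun k => hu k.1)
  obtain ⟨P, hP, hPe⟩ := ((isTrigPoly_interpolant hm0 y α β).mono
    (show 4 * m - 2 ≤ 2 * N by lia)).exists_polynomial
  refine ⟨P, hP, fun j => ?_, fun t ht hts => ?_⟩
  · have e := hPe (arccos (s j) / 2)
    rw [mul_div_cancel₀ _ (two_ne_zero), cos_arccos (hsI j).1 (hsI j).2] at e
    have e1 := h1 (j, 1) 0
    have e2 := h1 (j, -1) 0
    have e3 := h1 (j, 1) 1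
    have e4 := h1 (j, -1) (-1)
    rw [show y (j, 1) + (0 : ℤ) * (m * π) = m * (arccos (s j) / 2) by simp [y]] at e1
    rw [show y (j, -1) + (0 : ℤ) * (m * π) = m * -(arccos (s j) / 2) by simp [y]; ring] at e2
    rw [show y (j, 1) + (1 : ℤ) * (m * π) = m * (arccos (s j) / 2 + π) by simp [y]; ring] at e3
    rw [show y (j, -1) + (-1 : ℤ) * (m * π) = m * -(arccos (s j) / 2 + π) by
      simp [y]; ring] at e4
    rw [e, e1, e2, e3, e4]
    ring
  · have e := hPe (arccos t / 2)
    rw [mul_div_cancel₀ _ (two_ne_zero), cos_arccos ht.1 ht.2] at e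
    have hlt : ∀ z : ℝ, cos (2 * z) = t → ‖interpolant m y α β (m * z)‖ < 1 := by
      refine fun z hz => h2 _ fun k n hk => hts ⟨k.1, ?_⟩
      have hz' : 2 * z = (k.2 : ℤ) * arccos (s k.1) + n * (2 * π) := by
        simp only [y] at hk
        have : (m : ℝ) * (2 * z) = m * ((k.2 : ℤ) * arccos (s k.1) + n * (2 * π)) := by
          linear_combination 2 * hk
        exact mul_left_cancel₀ hmR.ne' this
      rw [← hz, hz', cos_add_int_mul_two_pi]
      rcases Int.units_eq_one_or k.2 with h | h <;> rw [h] <;>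
        simp [cos_arccos (hsI k.1).1 (hsI k.1).2]
    have hc : cos (2 * (arccos t / 2)) = t := by
      rw [mul_div_cancel₀ _ (two_ne_zero), cos_arccos ht.1 ht.2]
    have hc' : cos (2 * (arccos t / 2 + π)) = t := by
      rw [mul_add, cos_add_two_pi, hc]
    have l1 := hlt _ hc
    have l2 := hlt (-(arccos t / 2)) (by rw [mul_neg, cos_neg, hc])
    have l3 := hlt _ hc'
    have l4 := hlt (-(arccos t / 2 + π)) (by rw [mul_neg, cos_neg, hc'])
    rw [e, norm_div]
    have n4 : ‖(4 : ℂ)‖ = 4 := by norm_num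
    rw [n4, div_lt_one (by norm_num)]
    refine (norm_add_le_of_le (norm_add_le _ _) (norm_add_le _ _)).trans_lt ?_
    linarith

end DualCertificate

/-! ### Total variation of complex measures -/

section Measures

variable {M N : ℕ}

lemma pairing_dirac_sum (x : Fin M → I) (c : Fin M → ℂ) (h : ℝ → ℂ) :
    pairing h (∑ i, VectorMeasure.dirac (x i) (c i)) = ∑ i, h (x i) * c i := by
  rw [pairing, VectorMeasure.integral_finsetSum_vectorMeasure]
  · simp [VectorMeasure.integral_dirac]
  · intro i _
    rw [VectorMeasure.Integrable, VectorMeasure.variation_dirac]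
    exact (integrable_dirac (by simp)).smul_measure (by simp)

lemma tvNorm_dirac_sum_le (x : Fin M → I) (c : Fin M → ℂ) :
    tvNorm (∑ i, VectorMeasure.dirac (x i) (c i)) ≤ ∑ i, ‖c i‖ₑ := by
  have := VectorMeasure.variation_finsetSum_le Finset.univ
    fun i => VectorMeasure.dirac (x i) (c i)
  refine (this Set.univ).trans ?_
  simp [VectorMeasure.variation_dirac]

/-- A complex measure whose variation is carried by finitely many points is a sum of point
masses. -/
lemma eq_dirac_sum_of_variation_compl_eq_zero {x : Fin M → I} (hx : Function.Injective x)
    {h : ComplexMeasure I} (h0 : h.variation (Set.range x)ᶜ = 0) :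
    h = ∑ i, VectorMeasure.dirac (x i) (h {x i}) := by
  classical
  have hmeas : MeasurableSet (Set.range x) := (Set.finite_range x).measurableSet
  ext A hA
  have h1 : h (A \ Set.range x) = 0 :=
    (VectorMeasure.variation_apply_eq_zero hmeas.compl).1 h0 _ (fun y hy => hy.2) (hA.diff hmeas)
  have h2 : h (⋃ i ∈ Finset.univ.filter (fun i => x i ∈ A), {x i}) =
      ∑ i ∈ Finset.univ.filter (fun i => x i ∈ A), h {x i} :=
    VectorMeasure.of_biUnion_finset (fun i _ j _ hij => by simpa using hx.ne hij)
      (fun i _ => measurableSet_singleton _)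
  have h3 : (⋃ i ∈ Finset.univ.filter (fun i => x i ∈ A), {x i}) = A ∩ Set.range x := by
    ext y
    simp only [Finset.mem_filter, Finset.mem_univ, true_and, Set.mem_iUnion, Set.mem_singleton_iff,
      Set.mem_inter_iff, Set.mem_range]
    constructor
    · rintro ⟨i, hi, rfl⟩; exact ⟨hi, i, rfl⟩
    · rintro ⟨hy, i, rfl⟩; exact ⟨i, hy, rfl⟩
  have h4 : h A = h (A ∩ Set.range x) + h (A \ Set.range x) := by
    rw [← VectorMeasure.of_union _ (hA.inter hmeas) (hA.diff hmeas), Set.inter_union_sdiff]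
    exact Set.disjoint_sdiff_right.mono_left Set.inter_subset_right
  rw [h4, h1, add_zero, ← h3, h2, Finset.sum_filter, FunLike.coe_sum,
    Finset.sum_apply]
  refine Finset.sum_congr rfl fun i _ => ?_
  split_ifs with hi
  · rw [VectorMeasure.dirac_apply_of_mem hA hi]
  · rw [VectorMeasure.dirac_apply_of_notMem hi]

/-- The sign `conj z / |z|` of a complex number, with an arbitrary unimodular value at `0`. -/
lemma exists_unimodular_mul_eq_norm (z : ℂ) : ∃ u : ℂ, ‖u‖ = 1 ∧ u * z = ‖z‖ := by
  rcases eq_or_ne z 0 with rfl | hz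
  · exact ⟨1, by simp⟩
  · have hz' : (‖z‖ : ℂ) ≠ 0 := by simpa using hz
    refine ⟨(starRingEnd ℂ) z / ‖z‖, ?_, ?_⟩
    · rw [norm_div, RCLike.norm_conj, Complex.norm_real, norm_norm, div_self (by simpa using hz)]
    · rw [div_mul_eq_mul_div, mul_comm, Complex.mul_conj, Complex.normSq_eq_norm_sq]
      field_simp
      push_cast
      ring

/-- If all polynomials of degree at most `N` have the same integrals against `h` as against a
combination `g` of point masses at separated points, then `h` has larger total variation than
`g`, unless `h = g`. -/
theorem tvNorm_lt_of_pairing_eq (hN : 128 ≤ N) {x : Fin M → I} (hx : Function.Injective x)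
    (hsep : MinSeparated N (Set.range fun i => (x i : ℝ))) (c : Fin M → ℂ)
    {h : ComplexMeasure I}
    (hmom : ∀ P : ℂ[X], P.natDegree ≤ N → pairing (fun s => P.eval (s : ℂ)) h =
      pairing (fun s => P.eval (s : ℂ)) (∑ i, VectorMeasure.dirac (x i) (c i)))
    (hne : h ≠ ∑ i, VectorMeasure.dirac (x i) (c i)) :
    tvNorm (∑ i, VectorMeasure.dirac (x i) (c i)) < tvNorm h := by
  have hle := tvNorm_dirac_sum_le x c
  have hfin : ∑ i, ‖c i‖ₑ < ⊤ := by simp [ENNReal.sum_lt_top]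
  rcases eq_or_ne (tvNorm h) ⊤ with htop | htop
  · rw [htop]; exact hle.trans_lt hfin
  have hinj : Function.Injective fun i => (x i : ℝ) := Subtype.val_injective.comp hx
  have hfv : IsFiniteMeasure h.variation := ⟨lt_top_iff_ne_top.2 htop⟩
  have hcert := fun u hu => exists_dualCertificate hN hsep hinj (fun i => (x i).2) u hu
  by_cases h0 : h.variation (Set.range x)ᶜ = 0
  · -- `h` is carried by the same points, and polynomials separate the coefficients
    exfalso
    have hh := eq_dirac_sum_of_variation_compl_eq_zero hx h0
    choose u hu hu' using fun i => exists_unimodular_mul_eq_norm (h {x i} - c i)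
    obtain ⟨P, hP, hPu, -⟩ := hcert u hu
    have e := hmom P hP
    rw [hh, pairing_dirac_sum, pairing_dirac_sum, ← sub_eq_zero, ← Finset.sum_sub_distrib] at e
    have e2 : ∑ i, ‖h {x i} - c i‖ = 0 := by
      have : ((∑ i, ‖h {x i} - c i‖ : ℝ) : ℂ) = 0 := by
        rw [← e]
        push_cast
        refine Finset.sum_congr rfl fun i _ => ?_
        rw [← mul_sub, hPu, hu']
      exact_mod_cast this
    rw [Finset.sum_eq_zero_iff_of_nonneg fun i _ => norm_nonneg _] at e2
    apply hne
    rw [hh]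
    refine Finset.sum_congr rfl fun i hi => ?_
    rw [sub_eq_zero.1 (norm_eq_zero.1 (e2 i hi))]
  · choose u hu hu' using fun i => exists_unimodular_mul_eq_norm (c i)
    obtain ⟨P, hP, hPu, hPlt⟩ := hcert u hu
    have hle1 : ∀ s : I, ‖P.eval ((s : ℝ) : ℂ)‖ ≤ 1 := fun s => by
      by_cases hs : (s : ℝ) ∈ Set.range fun i => (x i : ℝ)
      · obtain ⟨i, hi⟩ := hs
        rw [← hi, hPu, hu]
      · exact (hPlt s s.2 hs).le
    have hcont : Continuous fun s : I => ‖P.eval ((s : ℝ) : ℂ)‖ :=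
      (P.continuous.comp (Complex.continuous_ofReal.comp continuous_subtype_val)).norm
    have hint : Integrable (fun s : I => ‖P.eval ((s : ℝ) : ℂ)‖) h.variation :=
      (integrable_const (1 : ℝ)).mono' hcont.aestronglyMeasurable
        (Filter.Eventually.of_forall fun s => by simpa using hle1 s)
    have e1 : ∑ i, ‖c i‖ ≤ ∫ s : I, ‖P.eval ((s : ℝ) : ℂ)‖ ∂h.variation := by
      have e := hmom P hP
      rw [pairing_dirac_sum] at e
      have e2 : ((∑ i, ‖c i‖ : ℝ) : ℂ) = pairing (fun s => P.eval (s : ℂ)) h := by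
        rw [e]
        push_cast
        exact Finset.sum_congr rfl fun i _ => by rw [hPu, hu']
      have e3 := VectorMeasure.norm_integral_le_integral_norm (μ := h)
        (B := ContinuousLinearMap.mul ℝ ℂ) (f := fun s : I => P.eval ((s : ℝ) : ℂ))
      rw [ContinuousLinearMap.opNorm_mul, one_mul] at e3
      refine le_trans ?_ e3
      change _ ≤ ‖pairing (fun s => P.eval (s : ℂ)) h‖
      rw [← e2, Complex.norm_real]
      exact le_abs_self _
    have e2 : ∫ s : I, ‖P.eval ((s : ℝ) : ℂ)‖ ∂h.variation < h.variation.real Set.univ := by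
      have hpos : 0 < ∫ s : I, (1 - ‖P.eval ((s : ℝ) : ℂ)‖) ∂h.variation := by
        rw [integral_pos_iff_support_of_nonneg (fun s => sub_nonneg.2 (hle1 s))
          ((integrable_const _).sub hint)]
        refine lt_of_lt_of_le (pos_iff_ne_zero.2 h0) (measure_mono fun s hs => ?_)
        have : ‖P.eval ((s : ℝ) : ℂ)‖ < 1 := hPlt s s.2 fun ⟨i, hi⟩ => hs ⟨i, Subtype.ext hi⟩
        exact (sub_pos.2 this).ne'
      rw [integral_sub (integrable_const _) hint, integral_const, smul_eq_mul, mul_one] at hpos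
      linarith
    refine hle.trans_lt ?_
    have e3 : ∑ i, ‖c i‖ₑ = ENNReal.ofReal (∑ i, ‖c i‖) := by
      rw [ENNReal.ofReal_sum_of_nonneg fun i _ => norm_nonneg _]
      simp
    rw [e3, ENNReal.ofReal_lt_iff_lt_toReal (Finset.sum_nonneg fun i _ => norm_nonneg _) htop]
    exact e1.trans_lt e2

/-- At most `N + 1` point evaluations are linearly independent on polynomials of degree at most
`N`. -/
lemma eq_zero_of_sum_eval_eq_zero {T : Finset ℝ} (hT : T.card ≤ N + 1) (w : ℝ → ℂ)
    (hw : ∀ P : ℂ[X], P.natDegree ≤ N → ∑ t ∈ T, w t * P.eval (t : ℂ) = 0) :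
    ∀ t ∈ T, w t = 0 := by
  classical
  intro t ht
  have hinj : Set.InjOn (fun t : ℝ => (t : ℂ)) T := Complex.ofReal_injective.injOn
  have h := hw (Lagrange.basis T (fun t : ℝ => (t : ℂ)) t) (by
    rw [Lagrange.natDegree_basis hinj ht]; lia)
  rw [Finset.sum_eq_single_of_mem t ht fun s hs hst => by
    rw [Lagrange.eval_basis_of_ne (v := fun t : ℝ => (t : ℂ)) hst.symm hs, mul_zero],
    Lagrange.eval_basis_self hinj ht, mul_one] at h
  exact h

/-- Separated points are few. -/
lemma card_le_of_minSeparated (hN : 2 ≤ N) {x : Fin M → I} (hx : Function.Injective x)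
    (hsep : MinSeparated N (Set.range fun i => (x i : ℝ))) : 4 * M ≤ N + 4 := by
  have hπ := Real.pi_pos
  have hNR : (0 : ℝ) < N := by exact_mod_cast (by lia : 0 < N)
  have hinj : Function.Injective fun i => (x i : ℝ) := Subtype.val_injective.comp hx
  have hb := arccos_bounds_of_minSeparated hN hsep
  -- in units of `4 π / N` the angles are `1`-separated and lie in `[1 / 2, N / 4)`
  let a : Fin M → ℝ := fun i => Real.arccos (x i) / (4 * Real.pi / N)
  have hu : 0 < 4 * Real.pi / N := by positivity
  have ha0 : ∀ i, 0 ≤ a i := fun i => by have := Real.arccos_nonneg (x i); positivity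
  have haN : ∀ i, a i < N / 4 := fun i => by
    rw [div_lt_iff₀ hu]
    have h1 := (hb i).2
    have h2 : 0 < 2 * Real.pi / N := by positivity
    have h3 : (N : ℝ) / 4 * (4 * Real.pi / N) = Real.pi := by field_simp
    linarith
  have hfl : Function.Injective fun i => ⌊a i⌋₊ := by
    intro i j hij
    by_contra hne
    have h1 := hsep.2 ⟨i, rfl⟩ ⟨j, rfl⟩ (hinj.ne hne)
    have h2 : 1 ≤ |a i - a j| := by
      rw [← sub_div, abs_div, abs_of_pos hu, le_div_iff₀ hu, one_mul]
      exact h1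
    have h3 := Nat.floor_le (ha0 i)
    have h4 := Nat.lt_floor_add_one (a i)
    have h5 := Nat.floor_le (ha0 j)
    have h6 := Nat.lt_floor_add_one (a j)
    simp only at hij
    rw [hij] at h3 h4
    rcases abs_cases (a i - a j) with h | h <;> linarith
  have hcard := Finset.card_le_card_of_injOn (s := Finset.univ) (t := Finset.range (N / 4 + 1))
    (fun i => ⌊a i⌋₊) (fun i _ => by
      rw [Finset.coe_range, Set.mem_Iio, Nat.lt_succ_iff, Nat.le_div_iff_mul_le (by norm_num)]
      have h3 := Nat.floor_le (ha0 i)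
      have h4 := haN i
      have : (⌊a i⌋₊ : ℝ) * 4 ≤ N := by linarith
      exact_mod_cast this) hfl.injOn
  simp at hcard
  lia

end Measures

/-! ### Splines as sums of truncated powers -/

section Splines

open Filter Topology Set

lemma iteratedDeriv_eval_ofReal (p : ℂ[X]) (k : ℕ) :
    iteratedDeriv k (fun t : ℝ => p.eval (t : ℂ)) =
      fun t : ℝ => (derivative^[k] p).eval (t : ℂ) := by
  induction k with
  | zero => simp
  | succ k ih =>
    rw [iteratedDeriv_succ, ih]
    ext t
    rw [Function.iterate_succ_apply']
    exact ((derivative^[k] p).hasDerivAt _).comp_ofReal.deriv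

lemma contDiff_eval_ofReal (p : ℂ[X]) {n : WithTop ℕ∞} :
    ContDiff ℝ n fun t : ℝ => p.eval (t : ℂ) := by
  have h : (fun t : ℝ => p.eval (t : ℂ)) =
      fun t : ℝ => ∑ i ∈ p.support, p.coeff i * (Complex.ofRealCLM t) ^ i := by
    ext t
    simp [Polynomial.eval_eq_sum, Polynomial.sum]
  rw [h]
  exact ContDiff.sum fun i _ => contDiff_const.mul (Complex.ofRealCLM.contDiff.pow i)

lemma uniqueDiffOn_I : UniqueDiffOn ℝ I := uniqueDiffOn_Icc (by norm_num)

/-- A function which is `C^k` on `[-1, 1]` and agrees with a polynomial on one side `s` of an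
interior point has there the `k`-th derivative of the polynomial. -/
lemma iteratedDerivWithin_eq_of_eventually_eval {f : ℝ → ℂ} {k : ℕ} (hf : ContDiffOn ℝ k f I)
    {a : ℝ} (ha : a ∈ Ioo (-1 : ℝ) 1) {s : Set ℝ} (hs : IsOpen s) [(𝓝[s] a).NeBot]
    {p : ℂ[X]} (hp : ∀ᶠ t in 𝓝[s] a, f t = p.eval (t : ℂ)) :
    iteratedDerivWithin k f I a = (derivative^[k] p).eval (a : ℂ) := by
  have hI : I ∈ 𝓝 a := Icc_mem_nhds ha.1 ha.2
  have hev : ∀ᶠ t in 𝓝[s] a, iteratedDerivWithin k f I t = (derivative^[k] p).eval (t : ℂ) := by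
    have h1 : ∀ᶠ t in 𝓝[s] a, t ∈ Ioo (-1 : ℝ) 1 :=
      mem_nhdsWithin_of_mem_nhds (isOpen_Ioo.mem_nhds ha)
    filter_upwards [eventually_eventually_nhdsWithin.2 hp, self_mem_nhdsWithin, h1]
      with t ht hts htI
    rw [hs.nhdsWithin_eq hts] at ht
    have htm : t ∈ I := Ioo_subset_Icc_self htI
    have h2 : f =ᶠ[𝓝[I] t] fun t : ℝ => p.eval (t : ℂ) := mem_nhdsWithin_of_mem_nhds ht
    rw [h2.iteratedDerivWithin_eq ht.self_of_nhds,
      iteratedDerivWithin_eq_iteratedDeriv uniqueDiffOn_I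
        (contDiff_eval_ofReal p).contDiffAt htm, iteratedDeriv_eval_ofReal]
  have hc : ContinuousAt (iteratedDerivWithin k f I) a :=
    (hf.continuousOn_iteratedDerivWithin le_rfl uniqueDiffOn_I).continuousAt hI
  have hc' : Continuous fun t : ℝ => (derivative^[k] p).eval (t : ℂ) :=
    (derivative^[k] p).continuous.comp Complex.continuous_ofReal
  refine tendsto_nhds_unique (l := 𝓝[s] a) (hc.mono_left nhdsWithin_le_nhds) ?_
  exact ((hc'.tendsto a).mono_left nhdsWithin_le_nhds).congr' (hev.mono fun t ht => ht.symm)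

lemma taylor_coeff_eq_div (p : ℂ[X]) (a : ℂ) (k : ℕ) :
    (taylor a p).coeff k = (derivative^[k] p).eval a / k ! := by
  rw [taylor_coeff, eq_div_iff (by exact_mod_cast k.factorial_ne_zero), mul_comm,
    ← factorial_smul_hasseDeriv]
  simp

/-- A polynomial of degree at most `r` which vanishes to order `r` at `a` is a multiple of
`(X - a) ^ r`. -/
lemma eq_C_mul_X_sub_C_pow {D : ℂ[X]} {r : ℕ} (hD : D.natDegree ≤ r) (a : ℂ)
    (h : ∀ k < r, (derivative^[k] D).eval a = 0) :
    D = C ((derivative^[r] D).eval a / r !) * (X - C a) ^ r := by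
  conv_lhs => rw [← sum_taylor_eq D a]
  rw [Polynomial.sum_over_range' _ (by simp) (r + 1)
    (by rw [natDegree_taylor]; omega), Finset.sum_range_succ, Finset.sum_eq_zero]
  · rw [zero_add, taylor_coeff_eq_div]
  · intro k hk
    rw [taylor_coeff_eq_div, h k (Finset.mem_range.1 hk)]
    simp

lemma sum_derivative_eval_mul_pow {p : ℂ[X]} {r : ℕ} (hp : p.natDegree ≤ r) (a t : ℂ) :
    p.eval t = ∑ j ∈ Finset.range (r + 1), (derivative^[j] p).eval a * (t - a) ^ j / j ! := by
  conv_lhs => rw [← sum_taylor_eq p a]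
  rw [Polynomial.sum_over_range' _ (by simp) (r + 1)
    (by rw [natDegree_taylor]; omega), Polynomial.eval_finsetSum]
  refine Finset.sum_congr rfl fun j _ => ?_
  rw [taylor_coeff_eq_div]
  simp
  ring

/-- Every point lies in one of the pieces cut out by the knots. -/
lemma exists_piece {M : ℕ} {x : Fin M → I} (hx : StrictMono x) (t : ℝ) :
    ∃ m : Fin (M + 1), ∀ i : Fin M, (x i : ℝ) ≤ t ↔ i.castSucc < m := by
  classical
  by_cases h : ∃ i, (x i : ℝ) ≤ t
  · obtain ⟨i₀, hi₀, hmax⟩ := (Finset.univ.filter fun i => (x i : ℝ) ≤ t).exists_max_image id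
      (by obtain ⟨i, hi⟩ := h; exact ⟨i, by simpa using hi⟩)
    simp only [Finset.mem_filter, Finset.mem_univ, true_and, id] at hi₀ hmax
    refine ⟨i₀.succ, fun i => ?_⟩
    rw [Fin.castSucc_lt_succ_iff]
    refine ⟨hmax i, fun hi => le_trans ?_ hi₀⟩
    exact_mod_cast hx.monotone hi
  · push Not at h
    exact ⟨0, fun i => by simpa using h i⟩

/-- Telescoping over the first `m` indices. -/
lemma sum_ite_castSucc_lt {M : ℕ} (v : Fin (M + 1) → ℂ) (m : Fin (M + 1)) :
    ∑ i : Fin M, (if i.castSucc < m then v i.succ - v i.castSucc else 0) = v m - v 0 := by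
  induction M with
  | zero =>
    obtain rfl : m = 0 := Fin.fin_one_eq_zero m
    simp
  | succ M ih =>
    induction m using Fin.cases with
    | zero => simp
    | succ m =>
      rw [Fin.sum_univ_succ]
      have := ih (fun i => v i.succ) m
      simp only [Fin.castSucc_zero, Fin.succ_pos, if_true, ← Fin.succ_castSucc,
        Fin.succ_lt_succ_iff]
      simp only [Fin.succ_castSucc] at this ⊢
      rw [this]
      simp

/-- The boundary terms at `t` of `r + 1` integrations by parts in `∫ p V_{r+1}`, where
`V 0, V 1, ...` are successive derivatives. -/
def boundaryForm (r : ℕ) (V : ℕ → ℝ → ℂ) (p : ℂ[X]) (t : ℝ) : ℂ :=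
  ∑ j ∈ Finset.range (r + 1), (-1) ^ j * (derivative^[j] p).eval (t : ℂ) * V (r - j) t

lemma boundaryForm_add (r : ℕ) (V : ℕ → ℝ → ℂ) (p₁ p₂ : ℂ[X]) (t : ℝ) :
    boundaryForm r V (p₁ + p₂) t = boundaryForm r V p₁ t + boundaryForm r V p₂ t := by
  simp only [boundaryForm, ← Finset.sum_add_distrib, iterate_map_add, eval_add]
  exact Finset.sum_congr rfl fun j _ => by ring

lemma boundaryForm_sum {ι : Type*} (s : Finset ι) (r : ℕ) (V : ℕ → ℝ → ℂ) (p : ι → ℂ[X])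
    (t : ℝ) : boundaryForm r V (∑ i ∈ s, p i) t = ∑ i ∈ s, boundaryForm r V (p i) t := by
  classical
  induction s using Finset.induction_on with
  | empty => simp [boundaryForm]
  | insert i s hi ih => rw [Finset.sum_insert hi, boundaryForm_add, ih, Finset.sum_insert hi]

lemma boundaryForm_truncatedPower (r : ℕ) (V : ℕ → ℝ → ℂ) (c : ℂ) (a : ℝ) :
    boundaryForm r V (C (c / r !) * (X - C (a : ℂ)) ^ r) a = (-1) ^ r * (c * V 0 a) := by
  have hr : (r ! : ℂ) ≠ 0 := by exact_mod_cast r.factorial_ne_zero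
  rw [boundaryForm, Finset.sum_range_succ, Finset.sum_eq_zero, zero_add]
  · rw [iterate_derivative_C_mul, iterate_derivative_X_sub_pow, Nat.descFactorial_self]
    simp only [Nat.sub_self, pow_zero, nsmul_eq_mul, mul_one, eval_mul, eval_C, eval_natCast]
    field_simp
  · intro j hj
    rw [Finset.mem_range] at hj
    rw [iterate_derivative_C_mul, iterate_derivative_X_sub_pow]
    simp [Nat.sub_ne_zero_of_lt hj]

variable {V : ℕ → ℝ → ℂ}

lemma hasDerivAt_boundaryForm (hV : ∀ k t, HasDerivAt (V k) (V (k + 1) t) t) {r : ℕ} {p : ℂ[X]}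
    (hp : p.natDegree ≤ r) (t : ℝ) :
    HasDerivAt (boundaryForm r V p) (p.eval (t : ℂ) * V (r + 1) t) t := by
  have hterm : ∀ j ∈ Finset.range (r + 1), HasDerivAt
      (fun t : ℝ => (-1) ^ j * (derivative^[j] p).eval (t : ℂ) * V (r - j) t)
      ((-1) ^ j * (derivative^[j] p).eval (t : ℂ) * V (r + 1 - j) t -
        (-1) ^ (j + 1) * (derivative^[j + 1] p).eval (t : ℂ) * V (r + 1 - (j + 1)) t) t := by
    intro j hj
    have hj' : r + 1 - j = r - j + 1 := by have := Finset.mem_range.1 hj; omega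
    have h := (((derivative^[j] p).hasDerivAt (t : ℂ)).comp_ofReal.const_mul ((-1) ^ j)).mul
      (hV (r - j) t)
    rw [hj', Nat.add_sub_add_right, Function.iterate_succ_apply']
    refine h.congr_deriv ?_
    ring
  have h := HasDerivAt.fun_sum hterm
  rw [Finset.sum_range_sub' (fun j => (-1) ^ j * (derivative^[j] p).eval (t : ℂ) *
    V (r + 1 - j) t)] at h
  refine h.congr_deriv ?_
  rw [iterate_derivative_eq_zero (Nat.lt_succ_of_le hp)]
  simp

lemma integral_eval_mul (hV : ∀ k t, HasDerivAt (V k) (V (k + 1) t) t) {r : ℕ} {p : ℂ[X]}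
    (hp : p.natDegree ≤ r) (a b : ℝ) :
    ∫ t in a..b, p.eval (t : ℂ) * V (r + 1) t =
      boundaryForm r V p b - boundaryForm r V p a := by
  refine intervalIntegral.integral_eq_sub_of_hasDerivAt
    (fun t _ => hasDerivAt_boundaryForm hV hp t) (Continuous.intervalIntegrable ?_ _ _)
  have hc : Continuous (V (r + 1)) :=
    continuous_iff_continuousAt.2 fun t => (hV (r + 1) t).continuousAt
  exact (p.continuous.comp Complex.continuous_ofReal).mul hc

lemma integral_ite_le {a : ℝ} (ha : a ∈ Ioo (-1 : ℝ) 1) {h : ℝ → ℂ} (hh : Continuous h) :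
    IntervalIntegrable (fun t => if a ≤ t then h t else 0) volume (-1) 1 ∧
    ∫ t in (-1 : ℝ)..1, (if a ≤ t then h t else 0) = ∫ t in a..1, h t := by
  have heq : (fun t => if a ≤ t then h t else 0) = (Ici a).indicator h := by
    ext t; simp [Set.indicator]
  rw [heq]
  constructor
  · rw [intervalIntegrable_iff_integrableOn_Ioc_of_le (by norm_num)]
    exact ((intervalIntegrable_iff_integrableOn_Ioc_of_le (by norm_num)).1
      (hh.intervalIntegrable (-1) 1)).indicator measurableSet_Ici
  · rw [intervalIntegral.integral_of_le (by norm_num), setIntegral_indicator measurableSet_Ici,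
      intervalIntegral.integral_of_le ha.2.le, ← integral_Icc_eq_integral_Ioc]
    congr 2
    ext t
    simp only [mem_inter_iff, mem_Ioc, mem_Ici, mem_Icc]
    exact ⟨fun h => ⟨h.2, h.1.2⟩, fun h => ⟨⟨ha.1.trans_le h.1, h.2⟩, h.1⟩⟩

/-- `f` is on `[-1, 1]` the sum of the polynomial `p` of degree at most `r` and of the truncated
powers with knots `x i` and `r`-th derivative jumping by `c i`. -/
structure IsTruncatedPowerSum (r : ℕ) {M : ℕ} (x : Fin M → I) (p : ℂ[X]) (c : Fin M → ℂ)
    (f : ℝ → ℂ) : Prop where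
  knots_mem : ∀ i, (x i : ℝ) ∈ Ioo (-1 : ℝ) 1
  natDegree_le : p.natDegree ≤ r
  eq_sum : ∀ t ∈ I, f t = p.eval (t : ℂ) +
    ∑ i, if (x i : ℝ) ≤ t then (C (c i / r !) * (X - C ((x i : ℝ) : ℂ)) ^ r).eval (t : ℂ) else 0

variable {r M : ℕ} {x : Fin M → I} {p : ℂ[X]} {c : Fin M → ℂ} {f : ℝ → ℂ}

/-- The truncated power representation of a spline. -/
lemma IsSpline.exists_truncatedPower (hf : IsSpline r x f) :
    ∃ (p : ℂ[X]) (c : Fin M → ℂ), IsTruncatedPowerSum r x p c f := by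
  obtain ⟨p, hpdeg, hp⟩ := hf.exists_pieces
  have hI : ∀ i, ∀ᶠ t in 𝓝 (x i : ℝ), t ∈ I := fun i =>
    Icc_mem_nhds (hf.knots_mem i).1 (hf.knots_mem i).2
  have hlt : ∀ {i j}, i < j → (x i : ℝ) < x j := fun h => by exact_mod_cast hf.strictMono_knots h
  have hle : ∀ {i j}, i ≤ j → (x i : ℝ) ≤ x j := fun h => by
    exact_mod_cast hf.strictMono_knots.monotone h
  have hleft : ∀ i, ∀ᶠ t in 𝓝[Iio (x i : ℝ)] (x i : ℝ),
      f t = (p i.castSucc).eval (t : ℂ) := by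
    intro i
    have h1 : ∀ᶠ t in 𝓝 (x i : ℝ), ∀ j, j < i → (x j : ℝ) ≤ t := by
      rw [eventually_all]
      intro j
      by_cases hj : j < i
      · filter_upwards [lt_mem_nhds (hlt hj)] with t ht _ using ht.le
      · exact Eventually.of_forall fun t h => absurd h hj
    filter_upwards [mem_nhdsWithin_of_mem_nhds h1, mem_nhdsWithin_of_mem_nhds (hI i),
      self_mem_nhdsWithin] with t h1 h2 h3
    refine hp _ t h2 fun j => ?_
    rw [Fin.castSucc_lt_castSucc_iff]
    refine ⟨fun h => ?_, h1 j⟩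
    by_contra! hij
    exact absurd (h.trans_lt h3) (not_lt.2 (hle hij))
  have hright : ∀ i, ∀ᶠ t in 𝓝[Ioi (x i : ℝ)] (x i : ℝ), f t = (p i.succ).eval (t : ℂ) := by
    intro i
    have h1 : ∀ᶠ t in 𝓝 (x i : ℝ), ∀ j, i < j → t < (x j : ℝ) := by
      rw [eventually_all]
      intro j
      by_cases hj : i < j
      · filter_upwards [gt_mem_nhds (hlt hj)] with t ht _ using ht
      · exact Eventually.of_forall fun t h => absurd h hj
    filter_upwards [mem_nhdsWithin_of_mem_nhds h1, mem_nhdsWithin_of_mem_nhds (hI i),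
      self_mem_nhdsWithin] with t h1 h2 h3
    refine hp _ t h2 fun j => ?_
    rw [Fin.castSucc_lt_succ_iff]
    refine ⟨fun h => ?_, fun h => (hle h).trans (le_of_lt h3)⟩
    by_contra! hij
    exact absurd h (not_le.2 (h1 j hij))
  have hjump : ∀ i, ∃ c : ℂ, p i.succ - p i.castSucc =
      C (c / r !) * (X - C ((x i : ℝ) : ℂ)) ^ r := by
    intro i
    refine ⟨_, eq_C_mul_X_sub_C_pow ((natDegree_sub_le _ _).trans
      (max_le (hpdeg _) (hpdeg _))) _ fun k hk => ?_⟩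
    rw [iterate_derivative_sub, eval_sub,
      ← iteratedDerivWithin_eq_of_eventually_eval (hf.contDiffOn k hk) (hf.knots_mem i) isOpen_Iio
        (hleft i),
      ← iteratedDerivWithin_eq_of_eventually_eval (hf.contDiffOn k hk) (hf.knots_mem i) isOpen_Ioi
        (hright i), sub_self]
  choose c hc using hjump
  refine ⟨p 0, c, hf.knots_mem, hpdeg 0, fun t ht => ?_⟩
  obtain ⟨m, hm⟩ := exists_piece hf.strictMono_knots t
  rw [hp m t ht hm, ← sub_eq_iff_eq_add', ← sum_ite_castSucc_lt (fun m => (p m).eval (t : ℂ)) m]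
  refine Finset.sum_congr rfl fun i _ => ?_
  simp only [hm i, ← hc i, eval_sub]

lemma bdryDeriv_eq_of_eventually {a : ℝ} (ha : a ∈ I) {p : ℂ[X]}
    (h : ∀ᶠ t in 𝓝 a, t ∈ I → f t = p.eval (t : ℂ)) (j : ℕ) :
    bdryDeriv f a j = (derivative^[j] p).eval (a : ℂ) := by
  have h' : f =ᶠ[𝓝[I] a] fun t : ℝ => p.eval (t : ℂ) := eventually_nhdsWithin_iff.2 h
  rw [bdryDeriv, h'.iteratedDerivWithin_eq (h.self_of_nhds ha),
    iteratedDerivWithin_eq_iteratedDeriv uniqueDiffOn_I (contDiff_eval_ofReal p).contDiffAt ha,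
    iteratedDeriv_eval_ofReal]

namespace IsTruncatedPowerSum

lemma bdryDeriv_neg_one (h : IsTruncatedPowerSum r x p c f) (j : ℕ) :
    bdryDeriv f (-1) j = (derivative^[j] p).eval (-1) := by
  have hev : ∀ᶠ t : ℝ in 𝓝 (-1 : ℝ), ∀ i, t < x i :=
    eventually_all.2 fun i => gt_mem_nhds (h.knots_mem i).1
  rw [bdryDeriv_eq_of_eventually (p := p) (by simp) (hev.mono fun t ht htI => ?_)]
  · simp
  · rw [h.eq_sum t htI, Finset.sum_eq_zero fun i _ => if_neg (not_le.2 (ht i)), add_zero]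

lemma bdryDeriv_one (h : IsTruncatedPowerSum r x p c f) (j : ℕ) :
    bdryDeriv f 1 j =
      (derivative^[j] (p + ∑ i, C (c i / r !) * (X - C ((x i : ℝ) : ℂ)) ^ r)).eval 1 := by
  have hev : ∀ᶠ t in 𝓝 (1 : ℝ), ∀ i, (x i : ℝ) < t :=
    eventually_all.2 fun i => lt_mem_nhds (h.knots_mem i).2
  rw [bdryDeriv_eq_of_eventually
    (p := p + ∑ i, C (c i / r !) * (X - C ((x i : ℝ) : ℂ)) ^ r) (by simp)
    (hev.mono fun t ht htI => ?_)]
  · simp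
  · rw [h.eq_sum t htI, eval_add, Polynomial.eval_finsetSum]
    exact congrArg _ (Finset.sum_congr rfl fun i _ => if_pos (ht i).le)

/-- Integration by parts of a spline against an `(r + 1)`-st derivative. -/
lemma integral_mul (h : IsTruncatedPowerSum r x p c f)
    (hV : ∀ k t, HasDerivAt (V k) (V (k + 1) t) t) :
    ∫ t in (-1 : ℝ)..1, f t * V (r + 1) t =
      ∑ j ∈ Finset.range (r + 1), (-1) ^ j *
        (bdryDeriv f 1 j * V (r - j) 1 - bdryDeriv f (-1) j * V (r - j) (-1)) +
      (-1) ^ (r + 1) * ∑ i, V 0 (x i) * c i := by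
  set e : Fin M → ℂ[X] := fun i => C (c i / r !) * (X - C ((x i : ℝ) : ℂ)) ^ r with he
  have hcV : Continuous (V (r + 1)) :=
    continuous_iff_continuousAt.2 fun t => (hV (r + 1) t).continuousAt
  have hcp : ∀ p : ℂ[X], Continuous fun t : ℝ => p.eval (t : ℂ) * V (r + 1) t := fun p =>
    (p.continuous.comp Complex.continuous_ofReal).mul hcV
  have hdeg : ∀ i, (e i).natDegree ≤ r := fun i =>
    (natDegree_C_mul_le _ _).trans (natDegree_pow_le_of_le r (natDegree_X_sub_C _).le |>.trans
      (by simp))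
  have hsplit : ∀ t ∈ uIcc (-1 : ℝ) 1, f t * V (r + 1) t = p.eval (t : ℂ) * V (r + 1) t +
      ∑ i, if (x i : ℝ) ≤ t then (e i).eval (t : ℂ) * V (r + 1) t else 0 := by
    intro t ht
    rw [uIcc_of_le (by norm_num)] at ht
    rw [h.eq_sum t ht, add_mul, Finset.sum_mul]
    simp only [ite_mul, zero_mul, he]
  have hint : ∀ i, IntervalIntegrable
      (fun t : ℝ => if (x i : ℝ) ≤ t then (e i).eval (t : ℂ) * V (r + 1) t else 0)
      volume (-1) 1 := fun i => (integral_ite_le (h.knots_mem i) (hcp (e i))).1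
  have hone : boundaryForm r V (p + ∑ i, e i) 1 =
      ∑ j ∈ Finset.range (r + 1), (-1) ^ j * (bdryDeriv f 1 j * V (r - j) 1) := by
    refine Finset.sum_congr rfl fun j _ => ?_
    rw [h.bdryDeriv_one]
    simp [he, mul_assoc]
  have hneg : boundaryForm r V p (-1) =
      ∑ j ∈ Finset.range (r + 1), (-1) ^ j * (bdryDeriv f (-1) j * V (r - j) (-1)) := by
    refine Finset.sum_congr rfl fun j _ => ?_
    rw [h.bdryDeriv_neg_one]
    simp [mul_assoc]
  rw [intervalIntegral.integral_congr hsplit, intervalIntegral.integral_add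
    ((hcp p).intervalIntegrable _ _) (by
      simpa only [Finset.sum_fn] using IntervalIntegrable.sum Finset.univ fun i _ => hint i),
    intervalIntegral.integral_finsetSum fun i _ => hint i, integral_eval_mul hV h.natDegree_le,
    Finset.sum_congr rfl fun i _ => (integral_ite_le (h.knots_mem i) (hcp (e i))).2.trans
      (integral_eval_mul hV (hdeg i) _ _), Finset.sum_sub_distrib]
  have hknots : ∑ i, boundaryForm r V (e i) (x i) = (-1) ^ r * ∑ i, V 0 (x i) * c i := by
    rw [Finset.mul_sum]
    refine Finset.sum_congr rfl fun i _ => ?_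
    rw [he, boundaryForm_truncatedPower, mul_comm (c i)]
  rw [boundaryForm_add, boundaryForm_sum] at hone
  simp only [mul_sub, Finset.sum_sub_distrib]
  rw [← hone, ← hneg, hknots]
  ring

lemma momentFromData_eq (h : IsTruncatedPowerSum r x p c f) {N : ℕ} {q : ℂ[X]}
    (hq : IsProjection N f q) {P : ℂ[X]} (hP : P.natDegree ≤ N) :
    momentFromData r q (bdryDeriv f (-1)) (bdryDeriv f 1) P =
      ∑ i, P.eval ((x i : ℝ) : ℂ) * c i := by
  have hV : ∀ (k : ℕ) (t : ℝ), HasDerivAt (fun t : ℝ => (derivative^[k] P).eval (t : ℂ))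
      ((derivative^[k + 1] P).eval (t : ℂ)) t := fun k t => by
    rw [Function.iterate_succ_apply']
    exact ((derivative^[k] P).hasDerivAt (t : ℂ)).comp_ofReal
  have hdeg : (derivative^[r + 1] P).natDegree ≤ N :=
    (natDegree_iterate_derivative P (r + 1)).trans ((Nat.sub_le _ _).trans hP)
  rw [momentFromData, ← hq.2 _ hdeg,
    h.integral_mul (V := fun k t => (derivative^[k] P).eval (t : ℂ)) hV, mul_add, ← mul_assoc,
    ← mul_pow, neg_one_mul, neg_neg, one_pow, one_mul, ← add_assoc, Finset.mul_sum,
    ← Finset.sum_range_reflect (fun j => (-1 : ℂ) ^ (r + 1) * _), ← Finset.sum_add_distrib,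
    Finset.sum_eq_zero, zero_add]
  · simp
  · intro j hj
    have hj' : j ≤ r := Nat.lt_succ_iff.1 (Finset.mem_range.1 hj)
    obtain ⟨k, rfl⟩ := Nat.exists_eq_add_of_le hj'
    have h1 : j + k + 1 - 1 - j = k := by omega
    have h2 : j + k - k = j := by omega
    have h3 : j + k - j = k := by omega
    have h4 : ((-1 : ℂ) ^ k) * (-1) ^ k = 1 := by rw [← mul_pow]; simp
    rw [h1, h2, h3]
    simp only [Complex.ofReal_one, Complex.ofReal_neg]
    linear_combination (-(-1) ^ j * (bdryDeriv f 1 k * (derivative^[j] P).eval 1 -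
      bdryDeriv f (-1) k * (derivative^[j] P).eval (-1))) * h4

lemma isDistribDeriv (h : IsTruncatedPowerSum r x p c f) :
    IsDistribDeriv (r + 1) f (∑ i, VectorMeasure.dirac (x i) (c i)) := by
  intro u hu _ hsupp
  have hV : ∀ (k : ℕ) (t : ℝ), HasDerivAt (iteratedDeriv k u) (iteratedDeriv (k + 1) u t) t := by
    intro k t
    rw [iteratedDeriv_succ]
    exact ((hu.differentiable_iteratedDeriv k (by exact_mod_cast ENat.natCast_lt_top k)) t).hasDerivAt
  have hzero : ∀ (k : ℕ) (t : ℝ), t ∉ Ioo (-1 : ℝ) 1 → iteratedDeriv k u t = 0 := by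
    intro k t ht
    have hev : u =ᶠ[𝓝 t] fun _ => 0 :=
      notMem_tsupport_iff_eventuallyEq.1 fun h => ht (hsupp h)
    rw [hev.iteratedDeriv_eq]
    simp
  rw [h.integral_mul (V := fun k => iteratedDeriv k u) hV, pairing_dirac_sum]
  simp [hzero]

lemma eq_integrateBack (h : IsTruncatedPowerSum r x p c f) {t : ℝ} (ht : t ∈ I) :
    f t = integrateBack r (bdryDeriv f (-1)) (∑ i, VectorMeasure.dirac (x i) (c i)) t := by
  rw [h.eq_sum t ht, integrateBack, pairing_dirac_sum,
    sum_derivative_eval_mul_pow h.natDegree_le (-1)]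
  congr 1
  · refine Finset.sum_congr rfl fun j _ => ?_
    rw [h.bdryDeriv_neg_one, sub_neg_eq_add]
  · refine Finset.sum_congr rfl fun i _ => ?_
    split_ifs
    · simp; ring
    · simp

end IsTruncatedPowerSum

end Splines

/-! ### Uniqueness from the projection and the boundary values -/

section Uniqueness

open Set

/-- A combination of at most `N + 1` point evaluations which kills the polynomials of degree at
most `N` kills all functions. -/
lemma sum_mul_eq_zero_of_forall_polynomial {ι : Type*} [Fintype ι] {N : ℕ}
    (hι : Fintype.card ι ≤ N + 1) (y : ι → ℝ) (d : ι → ℂ)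
    (hd : ∀ P : ℂ[X], P.natDegree ≤ N → ∑ i, d i * P.eval (y i : ℂ) = 0) (h : ℝ → ℂ) :
    ∑ i, d i * h (y i) = 0 := by
  classical
  have hsum : ∀ h : ℝ → ℂ, ∑ i, d i * h (y i) = ∑ t ∈ Finset.univ.image y,
      (∑ i with y i = t, d i) * h t := by
    intro h
    rw [← Finset.sum_fiberwise_of_maps_to (g := y)
      (fun i _ => Finset.mem_image_of_mem y (Finset.mem_univ i))]
    refine Finset.sum_congr rfl fun t _ => ?_
    rw [Finset.sum_mul]
    exact Finset.sum_congr rfl fun i hi => by rw [(Finset.mem_filter.1 hi).2]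
  have hw := eq_zero_of_sum_eval_eq_zero (N := N) (Finset.card_image_le.trans hι)
    (fun t => ∑ i with y i = t, d i)
    (fun P hP => by rw [← hsum fun t => P.eval (t : ℂ)]; exact hd P hP)
  rw [hsum]
  exact Finset.sum_eq_zero fun t ht => by rw [hw t ht, zero_mul]

lemma momentFromData_sub_momentFromData {r : ℕ} (q P : ℂ[X]) {a b a' b' : ℕ → ℂ}
    (hab : ∀ j < r, a' j = a j ∧ b' j = b j) :
    momentFromData r q a' b' P - momentFromData r q a b P =
      (b' r - b r) * P.eval 1 - (a' r - a r) * P.eval (-1) := by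
  have h : ∀ i ∈ Finset.range r, (-1 : ℂ) ^ (i + 1) *
      (b' (r - (i + 1)) * (derivative^[i + 1] P).eval 1 -
        a' (r - (i + 1)) * (derivative^[i + 1] P).eval (-1)) = (-1) ^ (i + 1) *
      (b (r - (i + 1)) * (derivative^[i + 1] P).eval 1 -
        a (r - (i + 1)) * (derivative^[i + 1] P).eval (-1)) := by
    intro i hi
    have := hab (r - (i + 1)) (by have := Finset.mem_range.1 hi; omega)
    rw [this.1, this.2]
  rw [momentFromData, momentFromData, Finset.sum_range_succ', Finset.sum_range_succ' _ r,
    Finset.sum_congr rfl h]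
  simp
  ring

/-- Splines with at most `N - 1` knots altogether that have the same projection and the same
boundary derivatives of order less than `r` coincide: the jumps of the `r`-th derivatives and the
differences of the `r`-th boundary derivatives are the weights of a combination of at most `N + 1`
point evaluations which kills the polynomials of degree at most `N`. -/
lemma IsTruncatedPowerSum.eq_of_isProjection {N r M M' : ℕ} {x : Fin M → I} {x' : Fin M' → I}
    {p p' : ℂ[X]} {c : Fin M → ℂ} {c' : Fin M' → ℂ} {f F : ℝ → ℂ}
    (hf : IsTruncatedPowerSum r x p c f) (hF : IsTruncatedPowerSum r x' p' c' F)
    (hcard : M' + M + 2 ≤ N + 1) {q : ℂ[X]} (hq : IsProjection N f q) (hq' : IsProjection N F q)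
    (hbd : ∀ j < r, bdryDeriv F (-1) j = bdryDeriv f (-1) j ∧ bdryDeriv F 1 j = bdryDeriv f 1 j)
    {t : ℝ} (ht : t ∈ I) : F t = f t := by
  set α := bdryDeriv F (-1) r - bdryDeriv f (-1) r with hα
  set β := bdryDeriv F 1 r - bdryDeriv f 1 r
  let y : Option (Option (Fin M' ⊕ Fin M)) → ℝ
    | none => -1
    | some none => 1
    | some (some (Sum.inl k)) => x' k
    | some (some (Sum.inr i)) => x i
  let d : Option (Option (Fin M' ⊕ Fin M)) → ℂ
    | none => α
    | some none => -β
    | some (some (Sum.inl k)) => c' k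
    | some (some (Sum.inr i)) => -c i
  have key := sum_mul_eq_zero_of_forall_polynomial (N := N) (by simpa using hcard) y d
    (fun P hP => by
      have h := momentFromData_sub_momentFromData q P hbd
      rw [hF.momentFromData_eq hq' hP, hf.momentFromData_eq hq hP] at h
      simp only [Fintype.sum_option, Fintype.sum_sum_type, y, d, neg_mul, Finset.sum_neg_distrib,
        Complex.ofReal_neg, Complex.ofReal_one]
      simp only [mul_comm (c' _), mul_comm (c _)]
      linear_combination h)
  simp only [Fintype.sum_option, Fintype.sum_sum_type, y, d, neg_mul,
    Finset.sum_neg_distrib] at key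
  have hα0 : α = 0 := by
    have h := key fun s => if s = -1 then 1 else 0
    have h1 : ∀ k, ¬ (x' k : ℝ) = -1 := fun k => (hF.knots_mem k).1.ne'
    have h2 : ∀ i, ¬ (x i : ℝ) = -1 := fun i => (hf.knots_mem i).1.ne'
    norm_num [h1, h2] at h
    exact h
  have hsum := key fun s => if s = -1 ∨ s = 1 then 0 else
    if s ≤ t then ((t : ℂ) - s) ^ r / r ! else 0
  have h1 : ∀ k, ¬ ((x' k : ℝ) = -1 ∨ (x' k : ℝ) = 1) := fun k h =>
    h.elim (hF.knots_mem k).1.ne' (hF.knots_mem k).2.ne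
  have h2 : ∀ i, ¬ ((x i : ℝ) = -1 ∨ (x i : ℝ) = 1) := fun i h =>
    h.elim (hf.knots_mem i).1.ne' (hf.knots_mem i).2.ne
  simp only [h1, h2, true_or, or_true, if_true, if_false, mul_zero, neg_zero, zero_add,
    add_neg_eq_zero] at hsum
  rw [hF.eq_integrateBack ht, hf.eq_integrateBack ht, integrateBack, integrateBack,
    pairing_dirac_sum, pairing_dirac_sum]
  simp only [mul_comm _ (c' _), mul_comm _ (c _)]
  rw [hsum]
  congr 1
  refine Finset.sum_congr rfl fun j hj => ?_
  rcases (Nat.lt_succ_iff.1 (Finset.mem_range.1 hj)).lt_or_eq with hj | rfl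
  · rw [(hbd j hj).1]
  · rw [sub_eq_zero.1 (hα.symm.trans hα0)]

end Uniqueness

end SplineRecovery

end

open SplineRecovery
theorem theorem3 (N : ℕ) (hN : 128 ≤ N) (r M : ℕ) (x : Fin M → I) (f : ℝ → ℂ)
    (hf : IsSpline r x f) (hsep : MinSeparated N (Set.range fun i => (x i : ℝ)))
    (q : ℂ[X]) (hq : IsProjection N f q) :
    -- recovery of the Dirac train `f^{(r+1)}` by TV minimization, and of `f` by integrating back
    (∃ (c : Fin M → ℂ) (g : ComplexMeasure I),
      g = ∑ i, VectorMeasure.dirac (x i) (c i) ∧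
      IsDistribDeriv (r + 1) f g ∧
      IsUniqueTVMinimizer (feasible N r q (bdryDeriv f (-1)) (bdryDeriv f 1)) g ∧
      ∀ t ∈ I, f t = integrateBack r (bdryDeriv f (-1)) g t) ∧
    -- the projection and the boundary values of order `j < r` already determine `f`
    (∀ (M' : ℕ) (x' : Fin M' → I) (F : ℝ → ℂ), IsSpline r x' F →
      MinSeparated N (Set.range fun i => (x' i : ℝ)) → IsProjection N F q →
      (∀ j < r, bdryDeriv F (-1) j = bdryDeriv f (-1) j ∧ bdryDeriv F 1 j = bdryDeriv f 1 j) →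
      ∀ t ∈ I, F t = f t) := by
  obtain ⟨p, c, h⟩ := hf.exists_truncatedPower
  have hx := hf.strictMono_knots.injective
  refine ⟨⟨c, _, rfl, h.isDistribDeriv, ⟨fun P hP => ?_, fun g hg hne => ?_⟩,
    fun t ht => h.eq_integrateBack ht⟩, fun M' x' F hF hsep' hq' hbd t ht => ?_⟩
  · rw [h.momentFromData_eq hq hP, pairing_dirac_sum]
  · refine tvNorm_lt_of_pairing_eq hN hx hsep c (fun P hP => ?_) hne
    rw [hg P hP, h.momentFromData_eq hq hP, pairing_dirac_sum]
  · obtain ⟨p', c', h'⟩ := hF.exists_truncatedPower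
    have h1 := card_le_of_minSeparated (by lia) hx hsep
    have h2 := card_le_of_minSeparated (by lia) hF.strictMono_knots.injective hsep'
    exact h.eq_of_isProjection h' (by lia) hq hq' hbd ht
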